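/- Let $G=(V,E)$ be a finite directed multigraph with source $s$ and sink $t\neq s$, such that every vertex is reachable from $s$ and $t$ is reachable from every vertex. Let every edge $e$ have a capacity $\nu_e>0$, a transit time $\tau_e\ge 0$ and a toll $c_e\ge 0$, let $u>0$ be the inflow rate at $s$, and put $\tau_{\max}=\max_e\tau_e$. **Deficit flows.** A deficit flow until time $T$ with initial queues $q\in\mathbb R_{\ge0}^E$ consists of nonnegative, locally integrable edge inflow and outflow rates $f_e^+,f_e^-:[0,\infty)\to\mathbb R_{\ge 0}$ such that $f_e^-=0$ on $[0,\tau_e)$ and the following hold. The queue mass $$z_e(\theta)=\int_0^\theta f_e^+\,d\xi-\int_0^{\theta+\tau_e}f_e^-\,d\xi+\nu_eq_e$$ is nonnegative; for all $\theta\ge0$, $f_e^-(\theta+\tau_e)=\nu_e$ if $z_e(\theta)>0$ and $f_e^-(\theta+\tau_e)=\min\{f_e^+(\theta),\nu_e\}$ if $z_e(\theta)=0$; and for all $\theta\ge0$ the net outflow $\sum_{e\in\delta^+(v)}f^+_e(\theta)-\sum_{e\in\delta^-(v)}f^-_e(\theta)$ is $u$ if $v=s$, is $\le0$ if $v=t$,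 is $\ge0$ if $v\ne s,t$, and is $0$ if $v\neq s,t$ and $\theta\ge T$. The queueing time on $e$ is $q_e(\theta)=z_e(\theta)/\nu_e$. **Steady state and equilibrium.** The flow is in steady state from time $0$ on if for every $e$ the derivative $q_e'(\theta)$ exists and is constant on $[0,\infty)$ (one-sided at $0$). Let $c_v(\theta)$ be the minimum cost (travel time including queueing, plus tolls) of reaching $t$ when starting at $v$ at time $\theta$. The flow is a dynamic equilibrium with tolls if for every edge $e=vw$ and almost all $\theta\ge0$, $f_e^+(\theta)>0$ implies $c_v(\theta)=\tau_e+q_e(\theta)+c_e+c_w(\theta+\tau_e+q_e(\theta))$. **Thin flows and the linear programs.** A source thin flow is a pair $(\bar y,\lambda)$, where $\bar y\ge0$ is an $s$-$t$-flow of value $u$ and $\lambda\in\mathbb R^V_{\ge0}$, such that $\lambda_s=1$, $\lambda_w=\min_{e=vw\in E}\max\{\lambda_v,\bar y_e/\nu_e\}$ for all $w\ne s$, and $\lambda_w=\max\{\lambda_v,\bar y_e/\nu_e\}$ for all $e=vw$ with $\bar y_e>0$. For positive $\lambda$, consider the LP of minimizing $\sum_{e=vw}\big(\tfrac{\lambda_t}{\lambda_w}\tau_e+c_e\big)y_e$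 over all $s$-$t$-flows $y\ge0$ of value $u$ with $y_e=\lambda_w\nu_e$ if $\lambda_w>\lambda_v$ and $y_e\le\lambda_w\nu_e$ if $\lambda_w\le\lambda_v$ ($e=vw$), and its dual of maximizing $u(d_s-d_t)-\sum_{e=vw}\lambda_w\nu_ep_e$ subject to $d_v-d_w-p_e\le\tfrac{\lambda_t}{\lambda_w}\tau_e+c_e$ for all $e=vw$ and $p_e\ge0$ whenever $\lambda_w\le\lambda_v$. **Theorem.** There is a deficit flow $f$ until time $\tau_{\max}$ with suitable initial queues $(q_e)_{e\in E}$ such that 1. $f_e^+$ is constant on $[0,\infty)$ for every $e\in E$; 2. $f$ is in steady state from time $0$ on; 3. $f$ is a dynamic equilibrium with tolls. Moreover, $f$ and $q$ can be chosen so that there are a source thin flow $(\bar y,\lambda)$ with $\lambda_s\le\lambda_v\le\lambda_t$ for all $v$, an optimal solution $y^*$ of the LP, and an optimal solution $(d^*,p^*)$ of its dual with $d^*_t=0$ and $p^*\ge0$, for which $f_e^+(\theta)=y_e^*/\lambda_v$ for all $\theta\ge0$ and $q_e=\tfrac{\lambda_w}{\lambda_t}p_e^*$ for every $e=vw\in E$.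 -/

import Mathlib

open MeasureTheory Set

/-- A tolled flow-over-time instance on a finite directed multigraph with vertex set `V` and edge
set `E`; the edge `e` goes from `src e` to `tgt e` (parallel edges and loops are allowed). -/
structure TolledInstance (V E : Type*) where
  src : E → V
  tgt : E → V
  s : V
  t : V
  s_ne_t : s ≠ t
  /-- every vertex is reachable from the source -/
  reach_from_s : ∀ v, Relation.ReflTransGen (fun a b => ∃ e, src e = a ∧ tgt e = b) s v
  /-- the sink is reachable from every vertex -/
  reach_t : ∀ v, Relation.ReflTransGen (fun a b => ∃ e, src e = a ∧ tgt e = b) v t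
  /-- constant network inflow rate `u` -/
  u : ℝ
  u_pos : 0 < u
  /-- capacities -/
  cap : E → ℝ
  cap_pos : ∀ e, 0 < cap e
  /-- transit times -/
  transit : E → ℝ
  transit_nonneg : ∀ e, 0 ≤ transit e
  /-- tolls -/
  toll : E → ℝ
  toll_nonneg : ∀ e, 0 ≤ toll e

namespace TolledInstance

variable {V E : Type*}

/-- The maximal transit time. -/
noncomputable def tauMax (I : TolledInstance V E) : ℝ := ⨆ e, I.transit e

/-- `∑_{e ∈ δ⁺(v)} out e - ∑_{e ∈ δ⁻(v)} inc e`. -/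
def net [Fintype E] [DecidableEq V] (I : TolledInstance V E) (out inc : E → ℝ) (v : V) : ℝ :=
  (∑ e with I.src e = v, out e) - ∑ e with I.tgt e = v, inc e

/-! ### Flows over time with initial queues -/

/-- Queue mass `z_e(θ) = F_e⁺(θ) - F_e⁻(θ + τ_e) + ν_e q_e`. Here `fin` and `fout` are the edge
inflow and outflow rates and `q` are the initial queues. -/
noncomputable def queueMass (I : TolledInstance V E) (q : E → ℝ) (fin fout : E → ℝ → ℝ)
    (e : E) (θ : ℝ) : ℝ :=
  (∫ ξ in (0 : ℝ)..θ, fin e ξ) - (∫ ξ in (0 : ℝ)..(θ + I.transit e), fout e ξ) + I.cap e * q e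

/-- Queueing time `q_e(θ) = z_e(θ) / ν_e`. -/
noncomputable def queueTime (I : TolledInstance V E) (q : E → ℝ) (fin fout : E → ℝ → ℝ)
    (e : E) (θ : ℝ) : ℝ :=
  I.queueMass q fin fout e θ / I.cap e

/-- `(fin, fout)` is a deficit flow until time `T` with initial queues `q`. Rates are functions of
time, of which only the values at times `θ ≥ 0` matter. -/
structure IsDeficitFlow [Fintype E] [DecidableEq V] (I : TolledInstance V E) (T : ℝ) (q : E → ℝ)
    (fin fout : E → ℝ → ℝ) : Prop where
  q_nonneg : ∀ e, 0 ≤ q e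
  fin_nonneg : ∀ e, ∀ θ, 0 ≤ θ → 0 ≤ fin e θ
  fout_nonneg : ∀ e, ∀ θ, 0 ≤ θ → 0 ≤ fout e θ
  fin_integrable : ∀ e, ∀ θ, 0 ≤ θ → IntervalIntegrable (fin e) volume 0 θ
  fout_integrable : ∀ e, ∀ θ, 0 ≤ θ → IntervalIntegrable (fout e) volume 0 θ
  /-- nothing leaves an edge before time `τ_e` -/
  fout_early : ∀ e, ∀ θ, 0 ≤ θ → θ < I.transit e → fout e θ = 0
  queue_nonneg : ∀ e, ∀ θ, 0 ≤ θ → 0 ≤ I.queueMass q fin fout e θ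
  fout_of_queue_pos : ∀ e, ∀ θ, 0 ≤ θ → 0 < I.queueMass q fin fout e θ →
    fout e (θ + I.transit e) = I.cap e
  fout_of_queue_zero : ∀ e, ∀ θ, 0 ≤ θ → I.queueMass q fin fout e θ = 0 →
    fout e (θ + I.transit e) = min (fin e θ) (I.cap e)
  net_source : ∀ θ, 0 ≤ θ → I.net (fun e => fin e θ) (fun e => fout e θ) I.s = I.u
  net_sink : ∀ θ, 0 ≤ θ → I.net (fun e => fin e θ) (fun e => fout e θ) I.t ≤ 0
  net_nonneg : ∀ v, v ≠ I.s → v ≠ I.t → ∀ θ, 0 ≤ θ →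
    0 ≤ I.net (fun e => fin e θ) (fun e => fout e θ) v
  net_eq_zero : ∀ v, v ≠ I.s → v ≠ I.t → ∀ θ, 0 ≤ θ → T ≤ θ →
    I.net (fun e => fin e θ) (fun e => fout e θ) v = 0

/-- Steady state from time `T` onward: each queueing time has a constant derivative on `[T, ∞)`
(the right derivative at the time `T` itself). -/
def IsSteadyFrom (I : TolledInstance V E) (q : E → ℝ) (fin fout : E → ℝ → ℝ) (T : ℝ) : Prop :=
  ∀ e, ∃ a : ℝ, ∀ θ, T ≤ θ → HasDerivWithinAt (I.queueTime q fin fout e) a (Ici T) θ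

/-! ### Costs and dynamic equilibria -/

/-- The list `p` of edges is a walk from `v` to the sink. -/
def IsWalkToSink (I : TolledInstance V E) : V → List E → Prop
  | v, [] => v = I.t
  | v, e :: p => I.src e = v ∧ I.IsWalkToSink (I.tgt e) p

/-- Cost (travel time plus tolls) of a particle that starts at time `θ` and follows the edges of
the list, when `Q e θ` is the queueing time on `e` for a particle that enters `e` at time `θ`. -/
def walkCost (I : TolledInstance V E) (Q : E → ℝ → ℝ) : List E → ℝ → ℝ
  | [], _ => 0
  | e :: p, θ =>
    I.transit e + Q e θ + I.toll e + I.walkCost Q p (θ + I.transit e + Q e θ)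

/-- `c_v(θ)`: the minimum cost to reach the sink starting from `v` at time `θ`. -/
noncomputable def minCost (I : TolledInstance V E) (Q : E → ℝ → ℝ) (v : V) (θ : ℝ) : ℝ :=
  sInf {x | ∃ p, I.IsWalkToSink v p ∧ x = I.walkCost Q p θ}

/-- The edge `e = vw` is active at time `θ`:
`c_v(θ) = τ_e + q_e(θ) + c_e + c_w(θ + τ_e + q_e(θ))`. -/
def IsActive (I : TolledInstance V E) (Q : E → ℝ → ℝ) (e : E) (θ : ℝ) : Prop :=
  I.minCost Q (I.src e) θ =
    I.transit e + Q e θ + I.toll e + I.minCost Q (I.tgt e) (θ + I.transit e + Q e θ)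

/-- Dynamic equilibrium with tolls: flow enters active edges only. -/
def IsDynamicEquilibrium (I : TolledInstance V E) (q : E → ℝ) (fin fout : E → ℝ → ℝ) : Prop :=
  ∀ e, ∀ᵐ θ ∂(volume.restrict (Ici (0 : ℝ))),
    0 < fin e θ → I.IsActive (I.queueTime q fin fout) e θ

theorem walkCost_nonneg (I : TolledInstance V E) (Q : E → ℝ → ℝ) (hQ : ∀ e θ, 0 ≤ θ → 0 ≤ Q e θ) :
   ∀ (p : List E) (θ : ℝ), 0 ≤ θ → 0 ≤ I.walkCost Q p θ
  | [], _, _ => le_rfl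
  | e :: p, θ, h => by
    have h1 := I.transit_nonneg e
    have h2 := I.toll_nonneg e
    have h3 := hQ e θ h
    have := walkCost_nonneg I Q hQ p (θ + I.transit e + Q e θ) (by positivity)
    simp only [walkCost]; positivity

theorem exists_walk (I : TolledInstance V E) (v : V) : ∃ p, I.IsWalkToSink v p := by
  induction I.reach_t v using Relation.ReflTransGen.head_induction_on with
  | refl => exact ⟨[], rfl⟩
  | head h _ ih => obtain ⟨e, rfl, rfl⟩ := h; obtain ⟨p, hp⟩ := ih; exact ⟨e :: p, rfl, hp⟩

/-- The minimum cost is zero at the sink (for nonnegative queueing times). -/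
theorem minCost_sink (I : TolledInstance V E) (Q : E → ℝ → ℝ) (hQ : ∀ e θ, 0 ≤ θ → 0 ≤ Q e θ)
    (θ : ℝ) (h : 0 ≤ θ) : I.minCost Q I.t θ = 0 := by
  apply IsLeast.csInf_eq
  refine ⟨⟨[], rfl, rfl⟩, ?_⟩
  rintro x ⟨p, -, rfl⟩; exact walkCost_nonneg I Q hQ p θ h

/-- Away from the sink the minimum cost satisfies the recursion
`c_v(θ) = min_{e = vw} (τ_e + q_e(θ) + c_e + c_w(θ + τ_e + q_e(θ)))`. -/
theorem minCost_isLeast [Finite E] (I : TolledInstance V E) (Q : E → ℝ → ℝ) (hQ : ∀ e θ, 0 ≤ θ → 0 ≤ Q e θ)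
    (v : V) (hv : v ≠ I.t) (θ : ℝ) (h : 0 ≤ θ) :
    IsLeast ((fun e => I.transit e + Q e θ + I.toll e + I.minCost Q (I.tgt e) (θ + I.transit e + Q e θ))
       '' {e | I.src e = v}) (I.minCost Q v θ) := by
  have bdd : ∀ v θ, 0 ≤ θ → BddBelow {x | ∃ p, I.IsWalkToSink v p ∧ x = I.walkCost Q p θ} := by
    intro v θ h; refine ⟨0, ?_⟩; rintro x ⟨p, -, rfl⟩; exact walkCost_nonneg I Q hQ p θ h
  have ne : ∀ v θ, Set.Nonempty {x | ∃ p, I.IsWalkToSink v p ∧ x = I.walkCost Q p θ} := by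
    intro v θ; obtain ⟨p, hp⟩ := I.exists_walk v; exact ⟨_, p, hp, rfl⟩
  have lb : ∀ e, I.src e = v → I.minCost Q v θ ≤ I.transit e + Q e θ + I.toll e + I.minCost Q (I.tgt e) (θ + I.transit e + Q e θ) := by
    intro e he
    rw [← sub_le_iff_le_add']
    apply le_csInf (ne _ _)
    rintro x ⟨p, hp, rfl⟩
    rw [sub_le_iff_le_add']
    exact csInf_le (bdd v θ h) ⟨e :: p, ⟨he, hp⟩, rfl⟩
  have hne : Set.Nonempty {e | I.src e = v} := by
    obtain ⟨p, hp⟩ := I.exists_walk v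
    cases p with
    | nil => exact absurd hp hv
    | cons e p => exact ⟨e, hp.1⟩
  obtain ⟨e, he, hmin⟩ := Set.exists_min_image {e | I.src e = v} (fun e => I.transit e + Q e θ + I.toll e + I.minCost Q (I.tgt e) (θ + I.transit e + Q e θ)) (Set.toFinite _) hne
  refine ⟨⟨e, he, le_antisymm ?_ (lb e he)⟩, ?_⟩
  · apply le_csInf (ne _ _)
    rintro x ⟨p, hp, rfl⟩
    cases p with
    | nil => exact absurd hp hv
    | cons f p =>
      refine (hmin f hp.1).trans ?_
      simp only [walkCost]
      gcongr
      have h1 := I.transit_nonneg f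
      have h3 := hQ f θ h
      exact csInf_le (bdd _ _ (by positivity)) ⟨p, hp.2, rfl⟩
  · rintro x ⟨f, hf, rfl⟩; exact lb f hf

/-! ### Thin flows and the linear programs -/

/-- `y` is a (static, nonnegative) `s`-`t`-flow of value `u`. -/
def IsSTFlow [Fintype E] [DecidableEq V] (I : TolledInstance V E) (y : E → ℝ) : Prop :=
  (∀ e, 0 ≤ y e) ∧ I.net y y I.s = I.u ∧ ∀ v, v ≠ I.s → v ≠ I.t → I.net y y v = 0

/-- `(y, lam)` is a source thin flow. -/
structure IsSourceThinFlow [Fintype E] [DecidableEq V] (I : TolledInstance V E)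
    (y : E → ℝ) (lam : V → ℝ) : Prop where
  flow : I.IsSTFlow y
  lam_nonneg : ∀ v, 0 ≤ lam v
  lam_source : lam I.s = 1
  lam_min : ∀ w, w ≠ I.s →
    IsLeast ((fun e => max (lam (I.src e)) (y e / I.cap e)) '' {e | I.tgt e = w}) (lam w)
  lam_flow : ∀ e, 0 < y e → lam (I.tgt e) = max (lam (I.src e)) (y e / I.cap e)

/-- Modified edge cost `(λ_t / λ_w) τ_e + c_e` of `e = vw`. -/
noncomputable def modCost (I : TolledInstance V E) (lam : V → ℝ) (e : E) : ℝ :=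
  lam I.t / lam (I.tgt e) * I.transit e + I.toll e

/-- Feasible solutions of the minimum cost flow LP. -/
structure PrimalFeasible [Fintype E] [DecidableEq V] (I : TolledInstance V E) (lam : V → ℝ)
    (y : E → ℝ) : Prop where
  flow : I.IsSTFlow y
  eq_cap : ∀ e, lam (I.src e) < lam (I.tgt e) → y e = lam (I.tgt e) * I.cap e
  le_cap : ∀ e, lam (I.tgt e) ≤ lam (I.src e) → y e ≤ lam (I.tgt e) * I.cap e

/-- Optimal solutions of the minimum cost flow LP. -/
def PrimalOptimal [Fintype E] [DecidableEq V] (I : TolledInstance V E) (lam : V → ℝ)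
    (y : E → ℝ) : Prop :=
  I.PrimalFeasible lam y ∧
    ∀ y', I.PrimalFeasible lam y' → ∑ e, I.modCost lam e * y e ≤ ∑ e, I.modCost lam e * y' e

/-- Feasible solutions of the dual LP. -/
structure DualFeasible (I : TolledInstance V E) (lam : V → ℝ) (d : V → ℝ) (p : E → ℝ) : Prop where
  le_cost : ∀ e, d (I.src e) - d (I.tgt e) - p e ≤ I.modCost lam e
  p_nonneg : ∀ e, lam (I.tgt e) ≤ lam (I.src e) → 0 ≤ p e

/-- Objective function of the dual LP. -/
def dualValue [Fintype E] (I : TolledInstance V E) (lam : V → ℝ) (d : V → ℝ) (p : E → ℝ) : ℝ :=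
  I.u * (d I.s - d I.t) - ∑ e, lam (I.tgt e) * I.cap e * p e

/-- Optimal solutions of the dual LP. -/
def DualOptimal [Fintype E] (I : TolledInstance V E) (lam : V → ℝ) (d : V → ℝ) (p : E → ℝ) :
    Prop :=
  I.DualFeasible lam d p ∧
    ∀ d' p', I.DualFeasible lam d' p' → I.dualValue lam d' p' ≤ I.dualValue lam d p

end TolledInstance

/-! Given thin flow labels `λ` and a static flow `y`, let flow enter `e = vw` at the constant rate
`y_e / λ_v` and leave it at rate `y_e / λ_w` from time `τ_e` on. Every queue is then affine in time,
and the guess for the minimum cost is also affine: `c_v(θ) = (λ_t / λ_v - 1) θ + d_v`. Put into the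
shortest path recursion, the terms in `θ` compare by the relation between `λ_v` and `λ_w`, and with
initial queue `q_e = (λ_w / λ_t) p_e` the constant terms become the dual constraint `d_v - d_w - p_e
≤ (λ_t / λ_w) τ_e + c_e`. Complementary slackness does the rest: the constraint is tight where `y_e
> 0`, which gives the equilibrium, and an edge with `p_e > 0` is saturated, as a positive queue
requires (`IsComplementary.potential_recursion`, `IsComplementary.isDeficitFlow`).

Thin flows come from a recursion on cuts (`exists_isPartialThinFlow`). Scale the capacities by the
least factor `M > 1` that makes the demand routable, if factor one is not enough. A cut becomes
tight; its far side gets the label `M`, and its near side is solved recursively with the saturated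
cut edges as additional demand. Routability is Gale's theorem, proved by least squares.

For the linear program, the equality constraints are relaxed to capacities. Pairing a flow with the
potential `λ` shows that nothing changes (`CapFeasible.eq_thinFlow`). The relaxed feasible set is
compact, so an optimum exists, and Farkas' lemma supplies the dual solution
(`exists_potential_of_isMin`). The optimum is also cleared of components that never lead to the
sink, so that the guessed costs are attained along flow-carrying walks.

Before all transit times have elapsed, inflow into vertices can only be missing, which is a
permitted deficit except at the source and the sink. There, monotonicity of `d` along the flow shows
that the relevant returning flow uses edges of transit time zero. -/

/-! ### Farkas' lemma -/

/-- **Farkas' lemma** for finitely many linear functionals. -/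
theorem exists_nonneg_combination_of_forall_nonneg {W ι : Type*} [AddCommGroup W] [Module ℝ W]
    (s : Finset ι) (a : ι → W →ₗ[ℝ] ℝ) (φ : W →ₗ[ℝ] ℝ)
    (h : ∀ x, (∀ i ∈ s, 0 ≤ a i x) → 0 ≤ φ x) :
    ∃ μ : ι → ℝ, (∀ i, 0 ≤ μ i) ∧ ∀ x, φ x = ∑ i ∈ s, μ i * a i x := by
  classical
  induction s using Finset.induction_on generalizing a φ with
  | empty =>
    refine ⟨0, fun _ => le_rfl, fun x => ?_⟩
    have h1 := h x (by simp)
    have h2 := h (-x) (by simp)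
    rw [map_neg] at h2
    simp only [Finset.sum_empty]
    linarith
  | insert j s hj ih =>
    by_cases hs : ∀ x, (∀ i ∈ s, 0 ≤ a i x) → 0 ≤ φ x
    · obtain ⟨μ, hμ, hφ⟩ := ih a φ hs
      refine ⟨Function.update μ j 0, fun i => ?_, fun x => ?_⟩
      · by_cases hij : i = j
        · subst hij; simp
        · simpa [hij] using hμ i
      · rw [Finset.sum_insert hj, hφ x]
        simp only [Function.update_self, zero_mul, zero_add]
        refine Finset.sum_congr rfl fun i hi => ?_
        rw [Function.update_of_ne (ne_of_mem_of_not_mem hi hj)]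
    · push Not at hs
      obtain ⟨z, hz, hφz⟩ := hs
      have hjz : a j z < 0 := by
        by_contra! hc
        exact absurd (h z (by simpa [hc] using hz)) (by linarith)
      set c := -(a j z) with hc
      have hc0 : 0 < c := by linarith
      -- All functionals are composed with the projection `x ↦ x + (a j x / c) • z` onto the kernel
      -- of `a j`, where the constraint `j` holds automatically. Undoing the projection leaves a
      -- multiple of `a j`, nonnegative because `φ z < 0 ≤ a i z`.
      obtain ⟨μ, hμ, hφ⟩ := ih (fun i => a i + (a i z / c) • a j) (φ + (φ z / c) • a j) (by
        intro x hx
        have key := h (x + (a j x / c) • z) (by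
          intro i hi
          rcases Finset.mem_insert.1 hi with rfl | hi
          · simp only [map_add, map_smul, smul_eq_mul]
            have : a i x / c * a i z = -a i x := by
              rw [show a i z = -c by simp [hc]]; field_simp
            linarith
          · have := hx i hi
            simp only [LinearMap.add_apply, LinearMap.smul_apply, map_add, map_smul,
              smul_eq_mul] at this ⊢
            convert this using 2
            ring)
        simp only [LinearMap.add_apply, LinearMap.smul_apply, map_add, map_smul,
          smul_eq_mul] at key ⊢
        convert key using 2
        ring)
      have hnn : 0 ≤ (∑ i ∈ s, μ i * (a i z / c)) - φ z / c := by
        have : 0 ≤ ∑ i ∈ s, μ i * (a i z / c) :=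
          Finset.sum_nonneg fun i hi => mul_nonneg (hμ i) (div_nonneg (hz i hi) hc0.le)
        have := div_neg_of_neg_of_pos hφz hc0
        linarith
      refine ⟨Function.update μ j ((∑ i ∈ s, μ i * (a i z / c)) - φ z / c), fun i => ?_,
        fun x => ?_⟩
      · by_cases hij : i = j
        · subst hij; simpa using hnn
        · simpa [hij] using hμ i
      · have hx := hφ x
        simp only [LinearMap.add_apply, LinearMap.smul_apply, smul_eq_mul, mul_add,
          Finset.sum_add_distrib] at hx
        have hupd : ∀ c' : ℝ, ∑ i ∈ s, Function.update μ j c' i * a i x = ∑ i ∈ s, μ i * a i x :=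
          fun c' => Finset.sum_congr rfl fun i hi => by
            rw [Function.update_of_ne (ne_of_mem_of_not_mem hi hj)]
        rw [Finset.sum_insert hj, Function.update_self, hupd, sub_mul, Finset.sum_mul]
        have : ∑ i ∈ s, μ i * (a i z / c * a j x) = ∑ i ∈ s, μ i * (a i z / c) * a j x :=
          Finset.sum_congr rfl fun i _ => by ring
        linarith

/-! ### Node balances and Gale's feasibility theorem -/

namespace TolledInstance

variable {V E : Type*} [DecidableEq V] [Fintype E]

/-- The net outflow at `v` as a linear functional of the flow. -/
def netLin (I : TolledInstance V E) (v : V) : (E → ℝ) →ₗ[ℝ] ℝ where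
  toFun y := I.net y y v
  map_add' y z := by simp only [net, Pi.add_apply, Finset.sum_add_distrib]; ring
  map_smul' c y := by
    simp only [net, Pi.smul_apply, smul_eq_mul, ← Finset.mul_sum, RingHom.id_apply]; ring

theorem continuous_net (I : TolledInstance V E) (v : V) :
    Continuous fun y : E → ℝ => I.net y y v := by
  unfold net; fun_prop

variable [Fintype V]

/-- Discrete integration by parts. The rigidity arguments below test a flow against a chosen
potential and read off that every edge term attains its bound. -/
theorem sum_mul_net (I : TolledInstance V E) (y z : E → ℝ) (g : V → ℝ) :
    ∑ v, g v * I.net y z v = ∑ e, (g (I.src e) * y e - g (I.tgt e) * z e) := by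
  simp only [net, mul_sub, Finset.sum_sub_distrib, Finset.mul_sum, Finset.sum_filter]
  congr 1 <;>
  · rw [Finset.sum_comm]
    refine Finset.sum_congr rfl fun e _ => ?_
    simp

theorem sum_mul_net_self (I : TolledInstance V E) (y : E → ℝ) (g : V → ℝ) :
    ∑ v, g v * I.net y y v = ∑ e, (g (I.src e) - g (I.tgt e)) * y e := by
  rw [sum_mul_net]; exact Finset.sum_congr rfl fun e _ => by ring

theorem sum_net (I : TolledInstance V E) (y : E → ℝ) : ∑ v, I.net y y v = 0 := by
  simpa using I.sum_mul_net_self y 1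

/-- A flow with net outflow as close as possible to `b` within the capacities saturates the edges
along which the residual decreases and avoids those along which it increases. -/
theorem exists_residual_complementary (I : TolledInstance V E) (k : E → ℝ) (hk : ∀ e, 0 ≤ k e)
    (b : V → ℝ) :
    ∃ y : E → ℝ, (∀ e, 0 ≤ y e ∧ y e ≤ k e) ∧ ∀ e,
      (b (I.tgt e) - I.net y y (I.tgt e) < b (I.src e) - I.net y y (I.src e) → y e = k e) ∧
      (b (I.src e) - I.net y y (I.src e) < b (I.tgt e) - I.net y y (I.tgt e) → y e = 0) := by
  obtain ⟨y, hy, hmin⟩ := (isCompact_Icc (a := (0 : E → ℝ)) (b := k)).exists_isMinOn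
    ⟨0, le_rfl, hk⟩ (f := fun y => ∑ v, (b v - I.net y y v) ^ 2)
    (Continuous.continuousOn (by
      have := I.continuous_net
      fun_prop))
  set r : V → ℝ := fun v => b v - I.net y y v with hr
  have var : ∀ y' ∈ Icc (0 : E → ℝ) k,
      ∑ e, (r (I.src e) - r (I.tgt e)) * (y' e - y e) ≤ 0 := by
    intro y' hy'
    have heq : ∑ e, (r (I.src e) - r (I.tgt e)) * (y' e - y e)
        = ∑ v, r v * I.netLin v (y' - y) := (I.sum_mul_net_self (y' - y) r).symm
    rw [heq]
    -- First-order condition: compare `y` with `y + t • (y' - y)`, divide by `t`, and later let `t`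
    -- tend to zero.
    have h0 : ∀ t ∈ Ioc (0 : ℝ) 1, ∑ v, r v * I.netLin v (y' - y)
        ≤ t * ∑ v, (I.netLin v (y' - y)) ^ 2 := by
      intro t ht
      have hmem : y + t • (y' - y) ∈ Icc (0 : E → ℝ) k := by
        have := (convex_Icc (0 : E → ℝ) k).add_smul_sub_mem hy hy' ⟨ht.1.le, ht.2⟩
        exact this
      have h1 : ∑ v, (r v) ^ 2 ≤ ∑ v, (b v - I.netLin v (y + t • (y' - y))) ^ 2 := hmin hmem
      have h2 : ∀ v, (b v - I.netLin v (y + t • (y' - y))) ^ 2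
          = r v ^ 2 - 2 * t * (r v * I.netLin v (y' - y)) + t ^ 2 * (I.netLin v (y' - y)) ^ 2 := by
        intro v
        have hv : r v = b v - I.netLin v y := rfl
        rw [map_add, map_smul, smul_eq_mul, hv]
        ring
      simp only [h2, Finset.sum_add_distrib, Finset.sum_sub_distrib, ← Finset.mul_sum] at h1
      have h3 : 0 ≤ ∑ v, (I.netLin v (y' - y)) ^ 2 := Finset.sum_nonneg fun v _ => sq_nonneg _
      have ht0 := ht.1
      have h4 : t * (2 * ∑ v, r v * I.netLin v (y' - y))
          ≤ t * (t * ∑ v, (I.netLin v (y' - y)) ^ 2) := by linarith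
      have h5 := le_of_mul_le_mul_left h4 ht0
      nlinarith [mul_nonneg ht0.le h3]
    have hlim : Filter.Tendsto (fun t : ℝ => t * ∑ v, (I.netLin v (y' - y)) ^ 2)
        (nhdsWithin 0 (Ioi 0)) (nhds 0) := by
      have : Continuous (fun t : ℝ => t * ∑ v, (I.netLin v (y' - y)) ^ 2) := by fun_prop
      simpa using (this.tendsto 0).mono_left nhdsWithin_le_nhds
    refine ge_of_tendsto hlim ?_
    filter_upwards [Ioc_mem_nhdsGT (zero_lt_one' ℝ)] with t ht using h0 t ht
  refine ⟨y, fun e => ⟨hy.1 e, hy.2 e⟩, ?_⟩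
  -- Each edge is pushed to the bound favoured by the residual difference. All terms of `var` are
  -- then nonnegative, so they vanish.
  set y' : E → ℝ := fun e => if r (I.tgt e) < r (I.src e) then k e
    else if r (I.src e) < r (I.tgt e) then 0 else y e with hy'
  have hnn : ∀ e, 0 ≤ (r (I.src e) - r (I.tgt e)) * (y' e - y e) := by
    intro e
    simp only [hy']
    split_ifs with h1 h2
    · exact mul_nonneg (by linarith) (by linarith [hy.2 e])
    · have h0 : 0 ≤ y e := hy.1 e
      exact mul_nonneg_of_nonpos_of_nonpos (by linarith) (by linarith)
    · simp
  have hz := (Finset.sum_eq_zero_iff_of_nonneg fun e _ => hnn e).1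
    (le_antisymm (var y' ⟨fun e => by
      simp only [hy']; split_ifs
      exacts [hk e, le_rfl, hy.1 e], fun e => by
      simp only [hy']; split_ifs
      exacts [le_rfl, hk e, hy.2 e]⟩) (Finset.sum_nonneg fun e _ => hnn e))
  intro e
  have hze := hz e (Finset.mem_univ e)
  refine ⟨fun h => ?_, fun h => ?_⟩
  · have h' : r (I.tgt e) < r (I.src e) := h
    simp only [hy', h', if_true, mul_eq_zero] at hze
    rcases hze with hze | hze <;> linarith
  · have h' : r (I.src e) < r (I.tgt e) := h
    simp only [hy', h', not_lt.2 h'.le, if_true, if_false, mul_eq_zero] at hze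
    rcases hze with hze | hze <;> linarith

/-- Gale's feasibility theorem: capacities that dominate the demand across every cut admit a
flow with the prescribed net outflows. -/
theorem exists_flow_of_cut (I : TolledInstance V E) (k : E → ℝ) (hk : ∀ e, 0 ≤ k e) (b : V → ℝ)
    (hb : ∑ v, b v = 0)
    (hcut : ∀ S : Finset V, ∑ v ∈ S, b v ≤ ∑ e with I.src e ∈ S ∧ I.tgt e ∉ S, k e) :
    ∃ y : E → ℝ, (∀ e, 0 ≤ y e ∧ y e ≤ k e) ∧ ∀ v, I.net y y v = b v := by
  obtain ⟨y, hy, hcomp⟩ := I.exists_residual_complementary k hk b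
  refine ⟨y, hy, ?_⟩
  set r : V → ℝ := fun v => b v - I.net y y v with hr
  have hsum : ∑ v, r v = 0 := by
    simp only [hr, Finset.sum_sub_distrib, hb, I.sum_net, sub_zero]
  obtain ⟨m, -, hm⟩ := Finset.univ.exists_max_image r ⟨I.s, Finset.mem_univ _⟩
  have hm0 : r m ≤ 0 := by
    by_contra! hpos
    -- Edges leaving this level set are full and edges entering it are empty, so its net outflow
    -- equals the cut capacity. The cut condition then contradicts a positive residual on it.
    set S : Finset V := {v | r v = r m} with hS
    have hnet : ∑ v ∈ S, I.net y y v = ∑ e with I.src e ∈ S ∧ I.tgt e ∉ S, k e := by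
      have := I.sum_mul_net_self y (fun v => if v ∈ S then 1 else 0)
      simp only [ite_mul, one_mul, zero_mul, ← Finset.sum_filter, Finset.filter_mem_eq_inter,
        Finset.univ_inter] at this
      rw [this, Finset.sum_filter]
      refine Finset.sum_congr rfl fun e _ => ?_
      have hlt : ∀ v, v ∉ S → r v < r m := fun v hv =>
        lt_of_le_of_ne (hm v (Finset.mem_univ v)) (by simpa [hS] using hv)
      by_cases h1 : I.src e ∈ S <;> by_cases h2 : I.tgt e ∈ S <;>
        simp only [h1, h2, if_true, if_false, not_true, not_false_iff, and_self, and_false,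
          sub_self, sub_zero, zero_mul, one_mul, zero_sub, and_true]
      · refine (hcomp e).1 ?_
        have h3 : r (I.src e) = r m := by simpa [hS] using h1
        exact (hlt _ h2).trans_eq h3.symm
      · have h3 : r (I.tgt e) = r m := by simpa [hS] using h2
        have := (hcomp e).2 ((hlt _ h1).trans_eq h3.symm)
        rw [this]; simp
    have h1 : ∑ v ∈ S, r v ≤ 0 := by
      simp only [hr, Finset.sum_sub_distrib, hnet]
      linarith [hcut S]
    have h2 : 0 < ∑ v ∈ S, r v := by
      refine Finset.sum_pos (fun v hv => ?_) ⟨m, by simp [hS]⟩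
      have : r v = r m := by simpa [hS] using hv
      rwa [this]
    linarith
  have hz := (Finset.sum_eq_zero_iff_of_nonpos
    fun v hv => (hm v hv).trans hm0).1 hsum
  intro v
  have := hz v (Finset.mem_univ v)
  simp only [hr] at this
  linarith

end TolledInstance

/-! ### Thin flows by recursion on tight cuts -/

namespace TolledInstance

variable {V E : Type*} [DecidableEq V]

/-- Every vertex of `A` is reachable from the source within `A`, expressed by cuts. -/
def CutConnected (I : TolledInstance V E) (A : Finset V) : Prop :=
  ∀ S ⊆ A, I.s ∈ S → S ≠ A → ∃ e, I.src e ∈ S ∧ I.tgt e ∈ A \ S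

theorem CutConnected.exists_mem_tgt {I : TolledInstance V E} {A : Finset V}
    (hconn : I.CutConnected A) (hs : I.s ∈ A) {w : V} (hw : w ∈ A) (hws : w ≠ I.s) :
    ∃ e, I.src e ∈ A ∧ I.tgt e = w := by
  obtain ⟨e, he1, he2⟩ := hconn (A.erase w) (Finset.erase_subset _ _)
    (Finset.mem_erase.2 ⟨hws.symm, hs⟩) (Finset.erase_ne_self.2 hw)
  refine ⟨e, Finset.mem_of_mem_erase he1, ?_⟩
  simp only [Finset.mem_sdiff, Finset.mem_erase] at he2
  tauto

variable [Fintype E]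

/-- Total capacity of the edges from `S` to `T`. -/
def cutCap (I : TolledInstance V E) (S T : Finset V) : ℝ :=
  ∑ e with I.src e ∈ S ∧ I.tgt e ∈ T, I.cap e

/-- Across every cut of `A` that separates the source, the demand is at most `Λ` times the
capacity. -/
def CutBound (I : TolledInstance V E) (A : Finset V) (b : V → ℝ) (Λ : ℝ) : Prop :=
  ∀ S ⊆ A, I.s ∈ S → ∑ v ∈ A \ S, b v ≤ Λ * I.cutCap S (A \ S)

theorem cutCap_nonneg (I : TolledInstance V E) (S T : Finset V) : 0 ≤ I.cutCap S T :=
  Finset.sum_nonneg fun e _ => (I.cap_pos e).le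

theorem cutCap_pos (I : TolledInstance V E) {S T : Finset V} {e : E} (h1 : I.src e ∈ S)
    (h2 : I.tgt e ∈ T) : 0 < I.cutCap S T :=
  Finset.sum_pos (fun e _ => I.cap_pos e) ⟨e, by simp [h1, h2]⟩

theorem cutCap_add_left (I : TolledInstance V E) {S' S : Finset V} (h : S' ⊆ S) (T : Finset V) :
    I.cutCap S T = I.cutCap S' T + I.cutCap (S \ S') T := by
  simp only [cutCap, Finset.sum_filter, ← Finset.sum_add_distrib, Finset.mem_sdiff]
  refine Finset.sum_congr rfl fun e _ => ?_
  by_cases h1 : I.src e ∈ S'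
  · simp [h1, h h1]
  · simp [h1]

theorem cutCap_add_right (I : TolledInstance V E) (S : Finset V) {T' T : Finset V} (h : T' ⊆ T) :
    I.cutCap S T = I.cutCap S T' + I.cutCap S (T \ T') := by
  simp only [cutCap, Finset.sum_filter, ← Finset.sum_add_distrib, Finset.mem_sdiff]
  refine Finset.sum_congr rfl fun e _ => ?_
  by_cases h1 : I.tgt e ∈ T'
  · simp [h1, h h1]
  · simp [h1]

theorem sum_cutCap_singleton (I : TolledInstance V E) (S T : Finset V) :
    ∑ v ∈ S, I.cutCap {v} T = I.cutCap S T := by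
  simp only [cutCap, Finset.sum_filter]
  rw [Finset.sum_comm]
  refine Finset.sum_congr rfl fun e _ => ?_
  by_cases h1 : I.tgt e ∈ T <;> simp [h1]

/-- If the capacities do not suffice, then scaling them up to the least sufficient factor makes
some cut tight, and the source side of the tight cut can be taken to be connected. -/
theorem exists_tight_cut (I : TolledInstance V E) {A : Finset V} {b : V → ℝ} {Λ : ℝ}
    (hconn : I.CutConnected A) (hb : ∀ v, 0 ≤ b v) (hΛ : I.CutBound A b Λ)
    (h1 : ¬ I.CutBound A b 1) :
    ∃ (M : ℝ) (S : Finset V), 1 < M ∧ M ≤ Λ ∧ I.CutBound A b M ∧ S ⊂ A ∧ I.s ∈ S ∧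
      ∑ v ∈ A \ S, b v = M * I.cutCap S (A \ S) ∧ I.CutConnected S := by
  have hpos : ∀ S ⊆ A, I.s ∈ S → S ≠ A → 0 < I.cutCap S (A \ S) := by
    intro S hS hs hne
    obtain ⟨e, he1, he2⟩ := hconn S hS hs hne
    exact I.cutCap_pos he1 he2
  set F : Finset (Finset V) := A.powerset.filter fun S => I.s ∈ S ∧ S ≠ A with hF
  have memF : ∀ S, S ∈ F ↔ S ⊆ A ∧ I.s ∈ S ∧ S ≠ A := by
    intro S; simp [hF]
  set r : Finset V → ℝ := fun S => (∑ v ∈ A \ S, b v) / I.cutCap S (A \ S) with hr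
  simp only [CutBound, not_forall, not_le, one_mul] at h1
  obtain ⟨S₁, hS₁, hs₁, hlt⟩ := h1
  have hS₁F : S₁ ∈ F := by
    refine (memF _).2 ⟨hS₁, hs₁, ?_⟩
    rintro rfl
    simp [cutCap] at hlt
  obtain ⟨S₀, hS₀F, hmax⟩ := F.exists_max_image r ⟨S₁, hS₁F⟩
  have hS₀ := (memF _).1 hS₀F
  have hM1 : 1 < r S₀ :=
    ((one_lt_div (hpos S₁ hS₁ hs₁ ((memF _).1 hS₁F).2.2)).2 hlt).trans_le (hmax S₁ hS₁F)
  have hMΛ : r S₀ ≤ Λ :=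
    (div_le_iff₀ (hpos S₀ hS₀.1 hS₀.2.1 hS₀.2.2)).2 (hΛ S₀ hS₀.1 hS₀.2.1)
  have hbound : I.CutBound A b (r S₀) := by
    intro S hS hs
    by_cases hne : S = A
    · subst hne; simp [cutCap]
    · exact (div_le_iff₀ (hpos S hS hs hne)).1 (hmax S ((memF _).2 ⟨hS, hs, hne⟩))
  -- A tight cut of least cardinality is connected: if no edge led from `S'` to `S \ S'`, then `S'`
  -- would have no more capacity and no less demand than `S`, hence be a smaller tight cut.
  obtain ⟨S, hSmem, hmin⟩ := (F.filter fun S => ∑ v ∈ A \ S, b v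
      = r S₀ * I.cutCap S (A \ S)).exists_min_image Finset.card ⟨S₀, by
    refine Finset.mem_filter.2 ⟨hS₀F, ?_⟩
    exact (div_mul_cancel₀ _ (hpos S₀ hS₀.1 hS₀.2.1 hS₀.2.2).ne').symm⟩
  obtain ⟨hSF, htight⟩ := Finset.mem_filter.1 hSmem
  obtain ⟨hSA, hsS, hSne⟩ := (memF _).1 hSF
  refine ⟨r S₀, S, hM1, hMΛ, hbound, Finset.ssubset_iff_subset_ne.2 ⟨hSA, hSne⟩, hsS, htight, ?_⟩
  intro S' hS' hsS' hne
  by_contra! hno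
  have hS'A := hS'.trans hSA
  have hz : I.cutCap S' (S \ S') = 0 := by
    refine Finset.sum_eq_zero fun e he => ?_
    obtain ⟨-, he⟩ := Finset.mem_filter.1 he
    exact absurd he.2 (hno e he.1)
  have hsub : A \ S ⊆ A \ S' := Finset.sdiff_subset_sdiff le_rfl hS'
  have hdiff : (A \ S') \ (A \ S) = S \ S' := by
    ext v
    have := @hSA v
    simp only [Finset.mem_sdiff]
    tauto
  have hc1 := I.cutCap_add_right S' hsub
  rw [hdiff, hz, add_zero] at hc1
  have hc2 := I.cutCap_add_left hS' (A \ S)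
  have hc3 := I.cutCap_nonneg (S \ S') (A \ S)
  have hb1 : ∑ v ∈ A \ S, b v ≤ ∑ v ∈ A \ S', b v :=
    Finset.sum_le_sum_of_subset_of_nonneg hsub fun v _ _ => hb v
  have hle := hbound S' hS'A hsS'
  have hS'ne : S' ≠ A := fun h => hne (hS'.antisymm (h ▸ hSA))
  have hcard := hmin S' (Finset.mem_filter.2 ⟨(memF _).2 ⟨hS'A, hsS', hS'ne⟩, by
    refine le_antisymm hle ?_
    rw [hc1]
    nlinarith⟩)
  exact absurd hcard (not_le.2 (Finset.card_lt_card (Finset.ssubset_iff_subset_ne.2 ⟨hS', hne⟩)))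

/-- A thin flow on the vertex set `A` that supplies the demands `b` from the source, with labels
between `1` and `Λ`. -/
structure IsPartialThinFlow (I : TolledInstance V E) (A : Finset V) (b : V → ℝ) (Λ : ℝ)
    (y : E → ℝ) (lam : V → ℝ) : Prop where
  one_le : ∀ v ∈ A, 1 ≤ lam v
  le_bound : ∀ v ∈ A, lam v ≤ Λ
  lam_source : lam I.s = 1
  nonneg : ∀ e, 0 ≤ y e
  support : ∀ e, ¬ (I.src e ∈ A ∧ I.tgt e ∈ A) → y e = 0
  net_eq : ∀ v ∈ A, v ≠ I.s → I.net y y v = - b v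
  eq_cap : ∀ e, I.src e ∈ A → I.tgt e ∈ A → lam (I.src e) < lam (I.tgt e) →
    y e = lam (I.tgt e) * I.cap e
  le_cap : ∀ e, I.src e ∈ A → I.tgt e ∈ A → y e ≤ lam (I.tgt e) * I.cap e
  eq_zero : ∀ e, I.src e ∈ A → I.tgt e ∈ A → lam (I.tgt e) < lam (I.src e) → y e = 0
  exists_pred : ∀ w ∈ A, w ≠ I.s → ∃ e, I.src e ∈ A ∧ I.tgt e = w ∧ lam (I.src e) ≤ lam w

/-- Gluing a thin flow on the source side of a tight cut to a capacity-respecting flow. -/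
theorem IsPartialThinFlow.glue {I : TolledInstance V E} {A S : Finset V} {b : V → ℝ} {M Λ : ℝ}
    (hconn : I.CutConnected A) (hSA : S ⊆ A) (hsS : I.s ∈ S) (hM1 : 1 ≤ M) (hMΛ : M ≤ Λ)
    {y y' : E → ℝ} {lam : V → ℝ} (hy0 : ∀ e, 0 ≤ y e) (hycap : ∀ e, y e ≤ M * I.cap e)
    (hsupp : ∀ e, ¬ (I.src e ∈ A ∧ I.tgt e ∈ A) → y e = 0)
    (hnet : ∀ v ∈ A, v ≠ I.s → I.net y y v = - b v)
    (hsat : ∀ e, (I.src e ∈ S → I.tgt e ∈ A \ S → y e = M * I.cap e) ∧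
      (I.src e ∉ S → I.tgt e ∈ S → y e = 0))
    (h : I.IsPartialThinFlow S (fun v => b v + M * I.cutCap {v} (A \ S)) M y' lam) :
    I.IsPartialThinFlow A b Λ (fun e => if I.tgt e ∈ S then y' e else y e)
      (fun v => if v ∈ S then lam v else M) where
  one_le v _ := by
    by_cases hv : v ∈ S
    · simpa [hv] using h.one_le v hv
    · simpa [hv] using hM1
  le_bound v _ := by
    by_cases hv : v ∈ S
    · simpa [hv] using (h.le_bound v hv).trans hMΛ
    · simpa [hv] using hMΛ
  lam_source := by simp [hsS, h.lam_source]
  nonneg e := by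
    split_ifs
    exacts [h.nonneg e, hy0 e]
  support e he := by
    split_ifs with h1
    · exact h.support e fun h2 => he ⟨hSA h2.1, hSA h2.2⟩
    · exact hsupp e he
  net_eq v hv hvs := by
    by_cases hvS : v ∈ S
    · have hn := h.net_eq v hvS hvs
      have hin : ∑ e with I.tgt e = v, (if I.tgt e ∈ S then y' e else y e)
          = ∑ e with I.tgt e = v, y' e :=
        Finset.sum_congr rfl fun e he => by
          rw [(Finset.mem_filter.1 he).2, if_pos hvS]
      -- The edges from `v` across the tight cut carry `M` times their capacity, which is exactly
      -- the extra demand charged to `v` in the subproblem on `S`.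
      have hout : ∑ e with I.src e = v, (if I.tgt e ∈ S then y' e else y e)
          = ∑ e with I.src e = v, y' e + M * I.cutCap {v} (A \ S) := by
        rw [cutCap, Finset.mul_sum]
        simp only [Finset.sum_filter, ← Finset.sum_add_distrib]
        refine Finset.sum_congr rfl fun e _ => ?_
        by_cases hev : I.src e = v
        · by_cases h1 : I.tgt e ∈ S
          · simp [hev, h1]
          · rw [h.support e fun h2 => h1 h2.2]
            by_cases h2 : I.tgt e ∈ A
            · have := (hsat e).1 (hev ▸ hvS) (Finset.mem_sdiff.2 ⟨h2, h1⟩)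
              simp [hev, h1, h2, this]
            · have := hsupp e fun h3 => h2 h3.2
              simp [hev, h1, h2, this]
        · simp [hev]
      unfold net at hn ⊢
      rw [hin, hout]
      linarith
    · have hn := hnet v hv hvs
      have hin : ∑ e with I.tgt e = v, (if I.tgt e ∈ S then y' e else y e)
          = ∑ e with I.tgt e = v, y e :=
        Finset.sum_congr rfl fun e he => by
          rw [(Finset.mem_filter.1 he).2, if_neg hvS]
      have hout : ∑ e with I.src e = v, (if I.tgt e ∈ S then y' e else y e)
          = ∑ e with I.src e = v, y e :=
        Finset.sum_congr rfl fun e he => by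
          have hev := (Finset.mem_filter.1 he).2
          have h1 : I.src e ∉ S := hev ▸ hvS
          split_ifs with h2
          · rw [(hsat e).2 h1 h2, h.support e fun h3 => h1 h3.1]
          · rfl
      unfold net at hn ⊢
      rw [hin, hout, hn]
  eq_cap e he1 he2 hlt := by
    by_cases h1 : I.src e ∈ S <;> by_cases h2 : I.tgt e ∈ S <;>
      simp only [h1, h2, if_true, if_false] at hlt ⊢
    · exact h.eq_cap e h1 h2 hlt
    · exact (hsat e).1 h1 (Finset.mem_sdiff.2 ⟨he2, h2⟩)
    · exact absurd hlt (not_lt.2 (h.le_bound _ h2))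
    · exact absurd hlt (lt_irrefl _)
  le_cap e he1 he2 := by
    by_cases h2 : I.tgt e ∈ S <;> simp only [h2, if_true, if_false]
    · by_cases h1 : I.src e ∈ S
      · exact h.le_cap e h1 h2
      · rw [h.support e fun h3 => h1 h3.1]
        have := h.one_le _ h2
        have := I.cap_pos e
        positivity
    · exact hycap e
  eq_zero e he1 he2 hlt := by
    by_cases h1 : I.src e ∈ S <;> by_cases h2 : I.tgt e ∈ S <;>
      simp only [h1, h2, if_true, if_false] at hlt ⊢
    · exact h.eq_zero e h1 h2 hlt
    · exact absurd hlt (not_lt.2 (h.le_bound _ h1))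
    · exact h.support e fun h3 => h1 h3.1
    · exact absurd hlt (lt_irrefl _)
  exists_pred w hw hws := by
    by_cases hwS : w ∈ S
    · obtain ⟨e, he1, he2, he3⟩ := h.exists_pred w hwS hws
      exact ⟨e, hSA he1, he2, by simpa [hwS, he1] using he3⟩
    · obtain ⟨e, he1, he2⟩ := hconn.exists_mem_tgt (hSA hsS) hw hws
      refine ⟨e, he1, he2, ?_⟩
      by_cases h1 : I.src e ∈ S
      · simpa [h1, hwS] using h.le_bound _ h1
      · simp [h1, hwS]

variable [Fintype V]

/-- This is Gale's theorem with capacities `Λ ν_e` inside `A` and zero elsewhere. The source injects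
the total demand, so sets without the source satisfy the cut condition trivially. -/
theorem exists_flow_of_cutBound (I : TolledInstance V E) {A : Finset V} (hs : I.s ∈ A)
    {b : V → ℝ} (hb : ∀ v, 0 ≤ b v) {Λ : ℝ} (hΛ0 : 0 ≤ Λ) (hΛ : I.CutBound A b Λ) :
    ∃ y : E → ℝ, (∀ e, 0 ≤ y e) ∧ (∀ e, y e ≤ Λ * I.cap e) ∧
      (∀ e, ¬ (I.src e ∈ A ∧ I.tgt e ∈ A) → y e = 0) ∧
      ∀ v, I.net y y v = (if v = I.s then ∑ v ∈ A, b v else 0) - if v ∈ A then b v else 0 := by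
  obtain ⟨y, hy, hnet⟩ := I.exists_flow_of_cut
    (fun e => if I.src e ∈ A ∧ I.tgt e ∈ A then Λ * I.cap e else 0)
    (fun e => by
      have := I.cap_pos e
      split_ifs <;> positivity)
    (fun v => (if v = I.s then ∑ v ∈ A, b v else 0) - if v ∈ A then b v else 0)
    (by simp [Finset.sum_sub_distrib, Finset.sum_ite_mem])
    (fun S => by
      have hsum : 0 ≤ ∑ v ∈ S ∩ A, b v := Finset.sum_nonneg fun v _ => hb v
      have hnn : 0 ≤ ∑ e with I.src e ∈ S ∧ I.tgt e ∉ S,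
          (if I.src e ∈ A ∧ I.tgt e ∈ A then Λ * I.cap e else 0) :=
        Finset.sum_nonneg fun e _ => by
          have := I.cap_pos e
          split_ifs <;> positivity
      simp only [Finset.sum_sub_distrib, Finset.sum_ite_eq', Finset.sum_ite_mem]
      by_cases hsS : I.s ∈ S
      · have h := hΛ (S ∩ A) Finset.inter_subset_right (Finset.mem_inter.2 ⟨hsS, hs⟩)
        have h2 := Finset.sum_sdiff (f := b) (Finset.inter_subset_right : S ∩ A ⊆ A)
        have h3 : Λ * I.cutCap (S ∩ A) (A \ (S ∩ A)) = ∑ e with I.src e ∈ S ∧ I.tgt e ∉ S,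
            (if I.src e ∈ A ∧ I.tgt e ∈ A then Λ * I.cap e else 0) := by
          rw [cutCap, Finset.mul_sum, ← Finset.sum_filter, Finset.filter_filter]
          refine Finset.sum_congr ?_ fun _ _ => rfl
          ext e
          simp only [Finset.mem_filter, Finset.mem_inter, Finset.mem_sdiff]
          tauto
        simp only [hsS, if_true]
        linarith
      · simp only [hsS, if_false]
        linarith)
  refine ⟨y, fun e => (hy e).1, fun e => (hy e).2.trans ?_, fun e he => ?_, hnet⟩
  · have := I.cap_pos e
    split_ifs
    · exact le_rfl
    · positivity
  · have := hy e
    simp only [he, if_false] at this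
    linarith

/-- A flow that respects the capacities saturates every tight cut. -/
theorem saturates_tight_cut (I : TolledInstance V E) {A S : Finset V} (hSA : S ⊆ A)
    (hsS : I.s ∈ S) {b : V → ℝ} {M : ℝ}
    (htight : ∑ v ∈ A \ S, b v = M * I.cutCap S (A \ S)) {y : E → ℝ} (hy0 : ∀ e, 0 ≤ y e)
    (hycap : ∀ e, y e ≤ M * I.cap e)
    (hsupp : ∀ e, ¬ (I.src e ∈ A ∧ I.tgt e ∈ A) → y e = 0)
    (hnet : ∀ v, I.net y y v =
      (if v = I.s then ∑ v ∈ A, b v else 0) - if v ∈ A then b v else 0) (e : E) :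
    (I.src e ∈ S → I.tgt e ∈ A \ S → y e = M * I.cap e) ∧
      (I.src e ∉ S → I.tgt e ∈ S → y e = 0) := by
  have hid := I.sum_mul_net_self y (fun v => if v ∈ S then 1 else 0)
  have hS : ∑ v, (if v ∈ S then (1 : ℝ) else 0) * I.net y y v = M * I.cutCap S (A \ S) := by
    simp only [ite_mul, one_mul, zero_mul, ← Finset.sum_filter, Finset.filter_mem_eq_inter,
        Finset.univ_inter]
    rw [← htight]
    simp only [hnet, Finset.sum_sub_distrib, Finset.sum_ite_eq', Finset.sum_ite_mem, hsS, if_true,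
      Finset.inter_eq_left.2 hSA]
    rw [← Finset.sum_sdiff hSA]
    ring
  rw [hS, cutCap, Finset.mul_sum, Finset.sum_filter] at hid
  -- Summed over the edges, both sides agree by tightness, so the bound is attained on each edge.
  have hle : ∀ e, ((if I.src e ∈ S then (1 : ℝ) else 0) - if I.tgt e ∈ S then 1 else 0) * y e
      ≤ if I.src e ∈ S ∧ I.tgt e ∈ A \ S then M * I.cap e else 0 := by
    intro e
    have h0 := hy0 e
    have h1 := hycap e
    have h2 := hsupp e
    by_cases hs1 : I.src e ∈ S <;> by_cases hs2 : I.tgt e ∈ S <;> by_cases hs3 : I.tgt e ∈ A <;>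
      simp_all
  have heq := (Finset.sum_eq_sum_iff_of_le fun e _ => hle e).1 hid.symm e (Finset.mem_univ e)
  refine ⟨fun h1 h2 => ?_, fun h1 h2 => ?_⟩
  · simpa [h1, h2, (Finset.mem_sdiff.1 h2).2] using heq
  · simpa [h1, h2] using heq

/-- Strong induction on `A`. If the unscaled capacities suffice, all labels are one. Otherwise the
subproblem on the near side of a tight cut is solved with label bound `M`, so that labels never
decrease across the cut when the solutions are glued. -/
theorem exists_isPartialThinFlow (I : TolledInstance V E) (A : Finset V) (hs : I.s ∈ A)
    (hconn : I.CutConnected A) (b : V → ℝ) (hb : ∀ v, 0 ≤ b v) (Λ : ℝ) (hΛ1 : 1 ≤ Λ)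
    (hΛ : I.CutBound A b Λ) :
    ∃ y lam, I.IsPartialThinFlow A b Λ y lam := by
  induction A using Finset.strongInduction generalizing b Λ with
  | H A ih =>
    by_cases h1 : I.CutBound A b 1
    · obtain ⟨y, hy0, hycap, hsupp, hnet⟩ := I.exists_flow_of_cutBound hs hb zero_le_one h1
      refine ⟨y, 1, fun _ _ => le_rfl, fun _ _ => hΛ1, rfl, hy0, hsupp, fun v hv hvs => ?_,
        fun e _ _ h => absurd h (lt_irrefl _), fun e _ _ => hycap e,
        fun e _ _ h => absurd h (lt_irrefl _), fun w hw hws => ?_⟩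
      · rw [hnet, if_neg hvs, if_pos hv, zero_sub]
      · obtain ⟨e, he1, he2⟩ := hconn.exists_mem_tgt hs hw hws
        exact ⟨e, he1, he2, le_rfl⟩
    · obtain ⟨M, S, hM1, hMΛ, hM, hSA, hsS, htight, hSconn⟩ := I.exists_tight_cut hconn hb hΛ h1
      have hM0 : 0 ≤ M := zero_le_one.trans hM1.le
      obtain ⟨y, hy0, hycap, hsupp, hnet⟩ := I.exists_flow_of_cutBound hs hb hM0 hM
      obtain ⟨y', lam, h⟩ := ih S hSA hsS hSconn (fun v => b v + M * I.cutCap {v} (A \ S))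
        (fun v => add_nonneg (hb v) (mul_nonneg hM0 (I.cutCap_nonneg _ _))) M hM1.le (by
          -- The cut condition of the subproblem is the one for `S'` in `A` minus the equality for
          -- the tight cut `S`; the capacity from `S'` to `A \ S` cancels.
          intro S' hS' hsS'
          have hle := hM S' (hS'.trans hSA.1) hsS'
          have hsub : A \ S ⊆ A \ S' := Finset.sdiff_subset_sdiff le_rfl hS'
          have hdiff : (A \ S') \ (A \ S) = S \ S' := by
            ext v
            have := @hSA.1 v
            simp only [Finset.mem_sdiff]
            tauto
          have hc1 := I.cutCap_add_right S' hsub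
          have hc2 := I.cutCap_add_left hS' (A \ S)
          have hb1 := Finset.sum_sdiff (f := b) hsub
          rw [hdiff] at hc1 hb1
          rw [Finset.sum_add_distrib, ← Finset.mul_sum, I.sum_cutCap_singleton]
          rw [hc1] at hle
          rw [hc2] at htight
          linarith)
      exact ⟨_, _, h.glue hconn hSA.1 hsS hM1.le hMΛ hy0 hycap hsupp
        (fun v hv hvs => by rw [hnet, if_neg hvs, if_pos hv, zero_sub])
        (I.saturates_tight_cut hSA.1 hsS htight hy0 hycap hsupp hnet)⟩

end TolledInstance

/-! ### The source thin flow -/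

namespace TolledInstance

variable {V E : Type*} [DecidableEq V] [Fintype E] [Fintype V]

theorem cutConnected_univ (I : TolledInstance V E) : I.CutConnected Finset.univ := by
  intro S _ hs hne
  by_contra! hno
  refine hne (Finset.eq_univ_iff_forall.2 fun v => ?_)
  induction I.reach_from_s v with
  | refl => exact hs
  | tail _ h ih =>
    obtain ⟨e, rfl, rfl⟩ := h
    have := hno e ih
    simpa using this

/-- For a flow, potential differences weighted by the flow sum up to the potential difference
between source and sink times the flow value. -/
theorem IsSTFlow.sum_potential {I : TolledInstance V E} {y : E → ℝ} (hy : I.IsSTFlow y)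
    (g : V → ℝ) : ∑ e, (g (I.src e) - g (I.tgt e)) * y e = I.u * (g I.s - g I.t) := by
  have hts : I.t ≠ I.s := I.s_ne_t.symm
  have split : ∀ g : V → ℝ, ∑ v, g v * I.net y y v = g I.s * I.u + g I.t * I.net y y I.t := by
    intro g
    rw [← hy.2.1]
    exact Fintype.sum_eq_add _ _ I.s_ne_t fun v hv => by rw [hy.2.2 v hv.1 hv.2, mul_zero]
  have h1 := split 1
  simp only [Pi.one_apply, one_mul, I.sum_net] at h1
  rw [← I.sum_mul_net_self, split]
  linear_combination g I.t * (-h1)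

/-- There is a source thin flow all of whose labels lie between those of source and sink. -/
theorem exists_isSourceThinFlow (I : TolledInstance V E) :
    ∃ (y : E → ℝ) (lam : V → ℝ), I.IsSourceThinFlow y lam ∧
      ∀ v, lam I.s ≤ lam v ∧ lam v ≤ lam I.t := by
  set b : V → ℝ := fun v => if v = I.t then I.u else 0 with hb
  have hb0 : ∀ v, 0 ≤ b v := fun v => by
    have := I.u_pos
    simp only [hb]
    split_ifs <;> linarith
  have hinv : ∀ e, 0 ≤ (I.cap e)⁻¹ := fun e => inv_nonneg.2 (I.cap_pos e).le
  obtain ⟨y, lam, h⟩ := I.exists_isPartialThinFlow Finset.univ (Finset.mem_univ _)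
    -- A proper cut contains some edge `e`, and `u / ν_e` times its capacity already covers the
    -- demand `u`. The summand one ensures `1 ≤ Λ`.
    I.cutConnected_univ b hb0 (1 + I.u * ∑ e, (I.cap e)⁻¹)
    (le_add_of_nonneg_right (mul_nonneg I.u_pos.le (Finset.sum_nonneg fun e _ => hinv e))) (by
      intro S hS hs
      by_cases hne : S = Finset.univ
      · subst hne; simp [cutCap]
      · obtain ⟨e, he1, he2⟩ := I.cutConnected_univ S hS hs hne
        have h1 : ∑ v ∈ Finset.univ \ S, b v ≤ I.u := by
          calc ∑ v ∈ Finset.univ \ S, b v ≤ ∑ v, b v :=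
                Finset.sum_le_sum_of_subset_of_nonneg (Finset.subset_univ _) fun v _ _ => hb0 v
            _ = I.u := by simp [hb]
        have h2 : I.cap e ≤ I.cutCap S (Finset.univ \ S) :=
          Finset.single_le_sum (fun e _ => (I.cap_pos e).le)
            (Finset.mem_filter.2 ⟨Finset.mem_univ e, he1, he2⟩)
        have h3 : (I.cap e)⁻¹ ≤ ∑ e, (I.cap e)⁻¹ :=
          Finset.single_le_sum (fun e _ => hinv e) (Finset.mem_univ e)
        have hc := I.cap_pos e
        have hu := I.u_pos
        calc ∑ v ∈ Finset.univ \ S, b v ≤ I.u * (I.cap e)⁻¹ * I.cap e := by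
              rw [mul_assoc, inv_mul_cancel₀ hc.ne', mul_one]; exact h1
          _ ≤ (1 + I.u * ∑ e, (I.cap e)⁻¹) * I.cutCap S (Finset.univ \ S) := by
              have := hinv e
              have h4 : I.u * (I.cap e)⁻¹ ≤ 1 + I.u * ∑ e, (I.cap e)⁻¹ := by
                have := mul_le_mul_of_nonneg_left h3 hu.le
                linarith
              exact mul_le_mul h4 h2 hc.le ((mul_nonneg hu.le this).trans h4))
  have one_le : ∀ v, 1 ≤ lam v := fun v => h.one_le v (Finset.mem_univ v)
  have eq_cap : ∀ e, lam (I.src e) < lam (I.tgt e) → y e = lam (I.tgt e) * I.cap e :=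
    fun e => h.eq_cap e (Finset.mem_univ _) (Finset.mem_univ _)
  have le_cap : ∀ e, y e ≤ lam (I.tgt e) * I.cap e :=
    fun e => h.le_cap e (Finset.mem_univ _) (Finset.mem_univ _)
  have eq_zero : ∀ e, lam (I.tgt e) < lam (I.src e) → y e = 0 :=
    fun e => h.eq_zero e (Finset.mem_univ _) (Finset.mem_univ _)
  have net_eq : ∀ v, v ≠ I.s → I.net y y v = - b v :=
    fun v hv => h.net_eq v (Finset.mem_univ v) hv
  have hflow : I.IsSTFlow y := by
    refine ⟨h.nonneg, ?_, fun v hvs hvt => by rw [net_eq v hvs]; simp [hb, hvt]⟩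
    have h1 : ∑ v, (I.net y y v + b v) = I.net y y I.s + b I.s :=
      Fintype.sum_eq_single _ fun v hv => by rw [net_eq v hv, neg_add_cancel]
    rw [Finset.sum_add_distrib, I.sum_net] at h1
    simp only [hb, Finset.sum_ite_eq', Finset.mem_univ, if_true, I.s_ne_t, if_false] at h1
    linarith
  have lam_le : ∀ e, lam (I.tgt e) ≤ max (lam (I.src e)) (y e / I.cap e) := by
    intro e
    rcases le_or_gt (lam (I.tgt e)) (lam (I.src e)) with hle | hlt
    · exact hle.trans (le_max_left _ _)
    · rw [eq_cap e hlt, mul_div_cancel_right₀ _ (I.cap_pos e).ne']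
      exact le_max_right _ _
  have max_eq : ∀ e, lam (I.src e) ≤ lam (I.tgt e) →
      max (lam (I.src e)) (y e / I.cap e) = lam (I.tgt e) := by
    intro e hle
    refine le_antisymm (max_le hle ?_) (lam_le e)
    rw [div_le_iff₀ (I.cap_pos e)]
    exact le_cap e
  refine ⟨y, lam, ⟨hflow, fun v => zero_le_one.trans (one_le v), h.lam_source, fun w hw => ?_,
    fun e he => ?_⟩, fun v => ⟨h.lam_source ▸ one_le v, ?_⟩⟩
  · obtain ⟨e, -, rfl, hle⟩ := h.exists_pred w (Finset.mem_univ w) hw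
    refine ⟨⟨e, rfl, max_eq e hle⟩, ?_⟩
    rintro x ⟨e', he', rfl⟩
    have he' : I.tgt e' = I.tgt e := he'
    exact he' ▸ lam_le e'
  · refine (max_eq e ?_).symm
    by_contra! hlt
    exact he.ne' (eq_zero e hlt)
  · by_contra! hv
    set S : Finset V := {v | lam v ≤ lam I.t} with hS
    have hmem : ∀ v, v ∈ S ↔ lam v ≤ lam I.t := fun v => by simp [hS]
    obtain ⟨e, he1, he2⟩ := I.cutConnected_univ S (Finset.subset_univ _)
      ((hmem _).2 (h.lam_source ▸ one_le _)) (fun h => by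
        have := (hmem v).1 (h ▸ Finset.mem_univ v)
        linarith)
    have he1 : lam (I.src e) ≤ lam I.t := (hmem _).1 he1
    have he2 : lam I.t < lam (I.tgt e) := by simpa [hmem] using he2
    -- This truncated potential agrees at source and sink and never decreases along the flow, so no
    -- flow can raise it. Yet `e` raises it and is saturated.
    have hid := hflow.sum_potential (fun v => max (lam v) (lam I.t))
    simp only [max_self, max_eq_right (h.lam_source ▸ one_le I.t : lam I.s ≤ lam I.t),
      sub_self, mul_zero] at hid
    have hle : ∀ e, (max (lam (I.src e)) (lam I.t) - max (lam (I.tgt e)) (lam I.t)) * y e ≤ 0 := by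
      intro e
      rcases le_or_gt (lam (I.src e)) (lam (I.tgt e)) with h1 | h1
      · exact mul_nonpos_of_nonpos_of_nonneg (sub_nonpos.2 (max_le_max_right _ h1)) (h.nonneg e)
      · rw [eq_zero e h1, mul_zero]
    have hz := (Finset.sum_eq_zero_iff_of_nonpos fun e _ => hle e).1 hid e (Finset.mem_univ e)
    rw [max_eq_right he1, max_eq_left he2.le, eq_cap e (he1.trans_lt he2)] at hz
    have := mul_pos (zero_lt_one.trans_le (one_le (I.tgt e))) (I.cap_pos e)
    nlinarith

end TolledInstance

/-! ### The linear program: optimality and complementary slackness -/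

namespace TolledInstance

variable {V E : Type*} [DecidableEq V] [Fintype E]

/-- `s`-`t`-flows that respect the capacities `λ_w ν_e`; for the labels of a source thin flow this
relaxation has the same feasible set as the linear program. -/
def CapFeasible (I : TolledInstance V E) (lam : V → ℝ) (y : E → ℝ) : Prop :=
  I.IsSTFlow y ∧ ∀ e, y e ≤ lam (I.tgt e) * I.cap e

/-- A capacity-respecting flow and dual variables in complementary slackness, where moreover
the sink is reachable along flow-carrying edges from everywhere the flow goes. -/
structure IsComplementary (I : TolledInstance V E) (lam : V → ℝ) (y : E → ℝ) (d : V → ℝ)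
    (p : E → ℝ) : Prop where
  feasible : I.CapFeasible lam y
  d_sink : d I.t = 0
  p_nonneg : ∀ e, 0 ≤ p e
  le_cost : ∀ e, d (I.src e) - d (I.tgt e) - p e ≤ I.modCost lam e
  eq_cost : ∀ e, 0 < y e → d (I.src e) - d (I.tgt e) - p e = I.modCost lam e
  eq_cap : ∀ e, 0 < p e → y e = lam (I.tgt e) * I.cap e
  reach : ∀ e, 0 < y e →
    Relation.ReflTransGen (fun a b => ∃ e, 0 < y e ∧ I.src e = a ∧ I.tgt e = b) (I.tgt e) I.t

theorem PrimalFeasible.capFeasible {I : TolledInstance V E} {lam : V → ℝ} {y : E → ℝ}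
    (h : I.PrimalFeasible lam y) : I.CapFeasible lam y :=
  ⟨h.flow, fun e => (lt_or_ge (lam (I.src e)) (lam (I.tgt e))).elim
    (fun hlt => (h.eq_cap e hlt).le) (h.le_cap e)⟩

theorem IsSourceThinFlow.eq_cap {I : TolledInstance V E} {y : E → ℝ} {lam : V → ℝ}
    (h : I.IsSourceThinFlow y lam) (hlam : ∀ v, lam I.s ≤ lam v) (e : E)
    (he : lam (I.src e) < lam (I.tgt e)) : y e = lam (I.tgt e) * I.cap e := by
  have hne : I.tgt e ≠ I.s := by
    intro hs
    have := hlam (I.src e)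
    rw [hs] at he
    linarith
  have hle : lam (I.tgt e) ≤ max (lam (I.src e)) (y e / I.cap e) :=
    (h.lam_min _ hne).2 ⟨e, rfl, rfl⟩
  have h1 : lam (I.tgt e) ≤ y e / I.cap e := (le_max_iff.1 hle).resolve_left (not_le.2 he)
  have hpos : 0 < y e := by
    have h2 : 0 < y e / I.cap e := ((h.lam_nonneg _).trans_lt he).trans_le h1
    exact (div_pos_iff_of_pos_right (I.cap_pos e)).1 h2
  have h3 := h.lam_flow e hpos
  rw [max_eq_right (he.le.trans h1)] at h3
  rw [h3, div_mul_cancel₀ _ (I.cap_pos e).ne']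

theorem IsSourceThinFlow.eq_zero {I : TolledInstance V E} {y : E → ℝ} {lam : V → ℝ}
    (h : I.IsSourceThinFlow y lam) (e : E) (he : lam (I.tgt e) < lam (I.src e)) : y e = 0 := by
  refine ((h.flow.1 e).eq_of_not_lt fun hpos => ?_).symm
  have h1 := h.lam_flow e hpos
  have := le_max_left (lam (I.src e)) (y e / I.cap e)
  linarith

theorem IsSourceThinFlow.capFeasible {I : TolledInstance V E} {y : E → ℝ} {lam : V → ℝ}
    (h : I.IsSourceThinFlow y lam) : I.CapFeasible lam y := by
  refine ⟨h.flow, fun e => ?_⟩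
  rcases (h.flow.1 e).eq_or_lt with h0 | hpos
  · rw [← h0]
    exact mul_nonneg (h.lam_nonneg _) (I.cap_pos e).le
  · rw [← div_le_iff₀ (I.cap_pos e), h.lam_flow e hpos]
    exact le_max_right _ _

theorem IsComplementary.dualFeasible {I : TolledInstance V E} {lam : V → ℝ} {y : E → ℝ}
    {d : V → ℝ} {p : E → ℝ} (h : I.IsComplementary lam y d p) : I.DualFeasible lam d p :=
  ⟨h.le_cost, fun e _ => h.p_nonneg e⟩

theorem exists_capFeasible_min (I : TolledInstance V E) {lam : V → ℝ} (c : E → ℝ)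
    (hne : ∃ y, I.CapFeasible lam y) :
    ∃ y, I.CapFeasible lam y ∧ ∀ y', I.CapFeasible lam y' → ∑ e, c e * y e ≤ ∑ e, c e * y' e := by
  have hcl : IsClosed {y | I.CapFeasible lam y} := by
    have := I.continuous_net
    simp only [CapFeasible, IsSTFlow, ofPred_and, ofPred_forall]
    refine ((isClosed_iInter fun e => isClosed_le (by fun_prop) (by fun_prop)).inter
      ((isClosed_eq (this _) continuous_const).inter (isClosed_iInter fun v =>
        isClosed_iInter fun _ => isClosed_iInter fun _ =>
          isClosed_eq (this _) continuous_const))).inter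
      (isClosed_iInter fun e => isClosed_le (by fun_prop) (by fun_prop))
  have hcpt : IsCompact {y | I.CapFeasible lam y} :=
    (isCompact_Icc (a := (0 : E → ℝ)) (b := fun e => lam (I.tgt e) * I.cap e)).of_isClosed_subset
      hcl fun y hy => ⟨hy.1.1, hy.2⟩
  obtain ⟨y, hy, hmin⟩ := hcpt.exists_isMinOn hne (f := fun y => ∑ e, c e * y e)
    (Continuous.continuousOn (by fun_prop))
  exact ⟨y, hy, fun y' hy' => hmin hy'⟩

/-- The vector `x` is a circulation pointing inward at every active bound. The other bounds are
strict and finitely many, so a small step along `x` stays feasible and cannot lower the cost. -/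
theorem sum_mul_nonneg_of_isMin (I : TolledInstance V E) {lam : V → ℝ} {c : E → ℝ} {y : E → ℝ}
    (hy : I.CapFeasible lam y)
    (hmin : ∀ y', I.CapFeasible lam y' → ∑ e, c e * y e ≤ ∑ e, c e * y' e) {x : E → ℝ}
    (hnet : ∀ v, I.netLin v x = 0) (h0 : ∀ e, y e = 0 → 0 ≤ x e)
    (hcap : ∀ e, y e = lam (I.tgt e) * I.cap e → x e ≤ 0) : 0 ≤ ∑ e, c e * x e := by
  have hev : ∀ᶠ ε in nhdsWithin (0 : ℝ) (Ioi 0), ∀ e,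
      0 ≤ y e + ε * x e ∧ y e + ε * x e ≤ lam (I.tgt e) * I.cap e := by
    rw [Filter.eventually_all]
    intro e
    have hlim : Filter.Tendsto (fun ε : ℝ => y e + ε * x e) (nhdsWithin 0 (Ioi 0)) (nhds (y e)) := by
      have : Continuous fun ε : ℝ => y e + ε * x e := by fun_prop
      simpa using (this.tendsto 0).mono_left nhdsWithin_le_nhds
    refine Filter.Eventually.and ?_ ?_
    · rcases (hy.1.1 e).eq_or_lt with hz | hpos
      · filter_upwards [self_mem_nhdsWithin] with ε hε
        rw [← hz, zero_add]
        exact mul_nonneg (le_of_lt hε) (h0 e hz.symm)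
      · exact (hlim.eventually_const_lt hpos).mono fun _ h => h.le
    · rcases (hy.2 e).eq_or_lt with hz | hlt
      · filter_upwards [self_mem_nhdsWithin] with ε hε
        have := mul_nonpos_of_nonneg_of_nonpos (le_of_lt hε) (hcap e hz)
        linarith
      · exact (hlim.eventually_lt_const hlt).mono fun _ h => h.le
  obtain ⟨ε, hε, hpos⟩ := (hev.and self_mem_nhdsWithin).exists
  have hpos : 0 < ε := hpos
  have hnet' : ∀ v, I.net (y + ε • x) (y + ε • x) v = I.net y y v := by
    intro v
    have : I.netLin v (y + ε • x) = I.netLin v y := by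
      rw [map_add, map_smul, hnet, smul_zero, add_zero]
    exact this
  have h1 := hmin (y + ε • x) ⟨⟨fun e => (hε e).1, by rw [hnet', hy.1.2.1],
    fun v hvs hvt => by rw [hnet', hy.1.2.2 v hvs hvt]⟩, fun e => (hε e).2⟩
  have h2 : ∑ e, c e * (y + ε • x) e = ∑ e, c e * y e + ε * ∑ e, c e * x e := by
    rw [Finset.mul_sum, ← Finset.sum_add_distrib]
    refine Finset.sum_congr rfl fun e _ => ?_
    simp only [Pi.add_apply, Pi.smul_apply, smul_eq_mul]
    ring
  rw [h2] at h1
  exact nonneg_of_mul_nonneg_right (by linarith) hpos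

variable [Fintype V]

/-- Every capacity-respecting flow agrees with the thin flow on the edges along which the labels
change. -/
theorem CapFeasible.eq_thinFlow {I : TolledInstance V E} {ybar y : E → ℝ} {lam : V → ℝ}
    (hy : I.CapFeasible lam y) (h : I.IsSourceThinFlow ybar lam) (hlam : ∀ v, lam I.s ≤ lam v)
    (e : E) (he : lam (I.src e) ≠ lam (I.tgt e)) : y e = ybar e := by
  -- Both flows have the same pairing with `lam`, while the thin flow minimizes each edge term
  -- separately.
  have hid := (hy.1.sum_potential lam).trans (h.flow.sum_potential lam).symm
  have hle : ∀ e, (lam (I.src e) - lam (I.tgt e)) * ybar e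
      ≤ (lam (I.src e) - lam (I.tgt e)) * y e := by
    intro e
    rcases lt_trichotomy (lam (I.src e)) (lam (I.tgt e)) with hlt | heq | hgt
    · rw [h.eq_cap hlam e hlt]
      exact mul_le_mul_of_nonpos_left (hy.2 e) (by linarith)
    · rw [heq]; simp
    · rw [h.eq_zero e hgt, mul_zero]
      exact mul_nonneg (by linarith) (hy.1.1 e)
  have := (Finset.sum_eq_sum_iff_of_le fun e _ => hle e).1 hid.symm e (Finset.mem_univ e)
  exact (mul_left_cancel₀ (sub_ne_zero.2 he) this).symm

theorem CapFeasible.eq_zero {I : TolledInstance V E} {ybar y : E → ℝ} {lam : V → ℝ}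
    (hy : I.CapFeasible lam y) (h : I.IsSourceThinFlow ybar lam) (hlam : ∀ v, lam I.s ≤ lam v)
    (e : E) (he : lam (I.tgt e) < lam (I.src e)) : y e = 0 :=
  (hy.eq_thinFlow h hlam e he.ne').trans (h.eq_zero e he)

theorem CapFeasible.primalFeasible {I : TolledInstance V E} {ybar y : E → ℝ} {lam : V → ℝ}
    (hy : I.CapFeasible lam y) (h : I.IsSourceThinFlow ybar lam) (hlam : ∀ v, lam I.s ≤ lam v) :
    I.PrimalFeasible lam y :=
  ⟨hy.1, fun e he => (hy.eq_thinFlow h hlam e he.ne).trans (h.eq_cap hlam e he), fun e _ => hy.2 e⟩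

/-- Weak duality. -/
theorem dualValue_le (I : TolledInstance V E) {lam : V → ℝ} {y : E → ℝ} {d : V → ℝ} {p : E → ℝ}
    (hy : I.PrimalFeasible lam y) (hd : I.DualFeasible lam d p) :
    I.dualValue lam d p ≤ ∑ e, I.modCost lam e * y e := by
  rw [dualValue, ← hy.flow.sum_potential d, ← Finset.sum_sub_distrib]
  refine Finset.sum_le_sum fun e _ => ?_
  have h1 := mul_le_mul_of_nonneg_right (hd.le_cost e) (hy.flow.1 e)
  rcases lt_or_ge (lam (I.src e)) (lam (I.tgt e)) with hlt | hge
  · rw [← hy.eq_cap e hlt]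
    linarith
  · have := mul_le_mul_of_nonneg_right (hy.le_cap e hge) (hd.p_nonneg e hge)
    linarith

theorem IsComplementary.dualValue_eq {I : TolledInstance V E} {lam : V → ℝ} {y : E → ℝ}
    {d : V → ℝ} {p : E → ℝ} (h : I.IsComplementary lam y d p) :
    I.dualValue lam d p = ∑ e, I.modCost lam e * y e := by
  rw [dualValue, ← h.feasible.1.sum_potential d, ← Finset.sum_sub_distrib]
  refine Finset.sum_congr rfl fun e _ => ?_
  have h1 : p e * (lam (I.tgt e) * I.cap e) = p e * y e := by
    rcases (h.p_nonneg e).eq_or_lt with h0 | hpos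
    · rw [← h0, zero_mul, zero_mul]
    · rw [h.eq_cap e hpos]
  rcases (h.feasible.1.1 e).eq_or_lt with h0 | hpos
  · rw [← h0, mul_zero] at h1
    rw [← h0]
    linarith
  · rw [← h.eq_cost e hpos]
    linarith

theorem IsComplementary.primalOptimal {I : TolledInstance V E} {ybar y : E → ℝ} {lam : V → ℝ}
    {d : V → ℝ} {p : E → ℝ} (h : I.IsComplementary lam y d p)
    (hthin : I.IsSourceThinFlow ybar lam) (hlam : ∀ v, lam I.s ≤ lam v) :
    I.PrimalOptimal lam y :=
  ⟨h.feasible.primalFeasible hthin hlam,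
    fun _ hy' => h.dualValue_eq ▸ I.dualValue_le hy' h.dualFeasible⟩

theorem IsComplementary.dualOptimal {I : TolledInstance V E} {ybar y : E → ℝ} {lam : V → ℝ}
    {d : V → ℝ} {p : E → ℝ} (h : I.IsComplementary lam y d p)
    (hthin : I.IsSourceThinFlow ybar lam) (hlam : ∀ v, lam I.s ≤ lam v) :
    I.DualOptimal lam d p :=
  ⟨h.dualFeasible, fun _ _ hd' =>
    (I.dualValue_le (h.feasible.primalFeasible hthin hlam) hd').trans_eq h.dualValue_eq.symm⟩

/-- A flow stays an `s`-`t`-flow when it is restricted to the vertices from which the sink is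
reachable along flow-carrying edges. -/
theorem IsSTFlow.exists_restriction {I : TolledInstance V E} {y : E → ℝ} (hy : I.IsSTFlow y) :
    ∃ y', I.IsSTFlow y' ∧ (∀ e, y' e ≤ y e) ∧ ∀ e, 0 < y' e →
      Relation.ReflTransGen (fun a b => ∃ e, 0 < y' e ∧ I.src e = a ∧ I.tgt e = b)
        (I.tgt e) I.t := by
  classical
  set W : V → Prop := fun v =>
    Relation.ReflTransGen (fun a b => ∃ e, 0 < y e ∧ I.src e = a ∧ I.tgt e = b) v I.t with hW
  have hWt : W I.t := Relation.ReflTransGen.refl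
  have hback : ∀ e, 0 < y e → W (I.tgt e) → W (I.src e) :=
    fun e he h => Relation.ReflTransGen.head ⟨e, he, rfl, rfl⟩ h
  -- By `hback` no flow enters `W` from outside, so all terms are nonpositive. A source outside `W`
  -- would make their sum `u > 0`; with the source in `W` the sum is zero, so no flow crosses the
  -- boundary of `W` in either direction.
  have hid := hy.sum_potential fun v => if W v then 0 else 1
  have hle : ∀ e, ((if W (I.src e) then (0 : ℝ) else 1) - if W (I.tgt e) then 0 else 1) * y e
      ≤ 0 := by
    intro e
    have h0 := hy.1 e
    rcases h0.eq_or_lt with h1 | hpos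
    · rw [← h1, mul_zero]
    · have := hback e hpos
      by_cases h1 : W (I.src e) <;> by_cases h2 : W (I.tgt e)
      · simp [h1, h2]
      · simpa [h1, h2] using h0
      · exact absurd (this h2) h1
      · simp [h1, h2]
  have hs : W I.s := by
    by_contra hs
    have h1 := Finset.sum_nonpos fun e (_ : e ∈ Finset.univ) => hle e
    rw [hid] at h1
    simp only [hs, hWt, if_true, if_false, sub_zero, mul_one] at h1
    linarith [I.u_pos]
  simp only [hs, hWt, if_true, sub_self, mul_zero] at hid
  have hz := (Finset.sum_eq_zero_iff_of_nonpos fun e _ => hle e).1 hid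
  have hiff : ∀ e, (if W (I.src e) then y e else 0) = if W (I.tgt e) then y e else 0 := by
    intro e
    have := hz e (Finset.mem_univ e)
    by_cases h1 : W (I.src e) <;> by_cases h2 : W (I.tgt e) <;>
      simp only [h1, h2, if_true, if_false] at this ⊢ <;> linarith
  have hnet : ∀ v, I.net (fun e => if W (I.src e) then y e else 0)
      (fun e => if W (I.src e) then y e else 0) v = if W v then I.net y y v else 0 := by
    intro v
    have hout : ∑ e with I.src e = v, (if W (I.src e) then y e else 0)
        = if W v then ∑ e with I.src e = v, y e else 0 := by
      rw [Finset.sum_congr rfl fun e he => by rw [(Finset.mem_filter.1 he).2]]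
      split_ifs <;> simp
    have hin : ∑ e with I.tgt e = v, (if W (I.src e) then y e else 0)
        = if W v then ∑ e with I.tgt e = v, y e else 0 := by
      rw [Finset.sum_congr rfl fun e he => by rw [hiff e, (Finset.mem_filter.1 he).2]]
      split_ifs <;> simp
    rw [net, net, hout, hin]
    split_ifs <;> simp
  refine ⟨fun e => if W (I.src e) then y e else 0, ⟨fun e => ?_, ?_, fun v hvs hvt => ?_⟩,
    fun e => ?_, fun e he => ?_⟩
  · have := hy.1 e
    dsimp only
    split_ifs <;> linarith
  · rw [hnet, if_pos hs, hy.2.1]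
  · rw [hnet, hy.2.2 v hvs hvt, ite_self]
  · have := hy.1 e
    dsimp only
    split_ifs <;> linarith
  · have htgt : W (I.tgt e) := by
      by_contra h
      dsimp only at he
      rw [hiff e, if_neg h] at he
      exact lt_irrefl _ he
    refine Relation.ReflTransGen.head_induction_on
      (motive := fun a _ => Relation.ReflTransGen (fun a b => ∃ e,
        0 < (if W (I.src e) then y e else 0) ∧ I.src e = a ∧ I.tgt e = b) a I.t)
      htgt Relation.ReflTransGen.refl ?_
    rintro a b ⟨e', he', rfl, rfl⟩ hb ih
    exact Relation.ReflTransGen.head ⟨e', by rwa [if_pos (hback e' he' hb)], rfl, rfl⟩ ih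

/-- Optimal capacity-respecting flows admit potentials and nonnegative edge prices in
complementary slackness. -/
theorem exists_potential_of_isMin (I : TolledInstance V E) {lam : V → ℝ} {c : E → ℝ} {y : E → ℝ}
    (hy : I.CapFeasible lam y)
    (hmin : ∀ y', I.CapFeasible lam y' → ∑ e, c e * y e ≤ ∑ e, c e * y' e) :
    ∃ (d : V → ℝ) (p : E → ℝ), d I.t = 0 ∧ (∀ e, 0 ≤ p e) ∧
      (∀ e, d (I.src e) - d (I.tgt e) - p e ≤ c e) ∧
      (∀ e, 0 < y e → d (I.src e) - d (I.tgt e) - p e = c e) ∧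
      ∀ e, 0 < p e → y e = lam (I.tgt e) * I.cap e := by
  classical
  -- The inequalities cut out the cone of feasible directions; conservation enters as two opposite
  -- inequalities at each vertex. Their multipliers become the potential, the reduced costs of empty
  -- edges and the prices of full edges.
  set a : V ⊕ V ⊕ E ⊕ E → (E → ℝ) →ₗ[ℝ] ℝ := Sum.elim I.netLin (Sum.elim (fun v => -I.netLin v)
    (Sum.elim (fun e => if y e = 0 then LinearMap.proj e else 0)
      fun e => if y e = lam (I.tgt e) * I.cap e then -LinearMap.proj e else 0)) with ha
  obtain ⟨μ, hμ, hφ⟩ := exists_nonneg_combination_of_forall_nonneg Finset.univ a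
    (∑ e, c e • LinearMap.proj e) (by
      intro x hx
      have h1 : ∀ v, 0 ≤ I.netLin v x := fun v => hx (.inl v) (Finset.mem_univ _)
      have h2 : ∀ v, 0 ≤ -I.netLin v x := fun v => hx (.inr (.inl v)) (Finset.mem_univ _)
      have h3 : 0 ≤ ∑ e, c e * x e := by
        refine I.sum_mul_nonneg_of_isMin hy hmin
          (fun v => le_antisymm (by linarith [h2 v]) (h1 v)) (fun e he => ?_) (fun e he => ?_)
        · simpa [ha, he] using hx (.inr (.inr (.inl e))) (Finset.mem_univ _)
        · have := hx (.inr (.inr (.inr e))) (Finset.mem_univ _)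
          simp only [ha, Sum.elim_inr, if_pos he] at this
          simpa using this
      simpa using h3)
  set d : V → ℝ := fun v => μ (.inl v) - μ (.inr (.inl v)) with hd
  set r : E → ℝ := fun e => if y e = 0 then μ (.inr (.inr (.inl e))) else 0 with hr
  set p : E → ℝ := fun e =>
    if y e = lam (I.tgt e) * I.cap e then μ (.inr (.inr (.inr e))) else 0 with hp
  have key : ∀ e, c e = d (I.src e) - d (I.tgt e) + r e - p e := by
    have hx : ∀ x : E → ℝ, ∑ e, c e * x e
        = ∑ e, (d (I.src e) - d (I.tgt e) + r e - p e) * x e := by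
      intro x
      have h1 := hφ x
      have h2 : ∑ v, d v * I.netLin v x = ∑ e, (d (I.src e) - d (I.tgt e)) * x e :=
        I.sum_mul_net_self x d
      have h3 : ∀ e, μ (.inr (.inr (.inl e))) * a (.inr (.inr (.inl e))) x = r e * x e := by
        intro e
        simp only [ha, hr, Sum.elim_inr, Sum.elim_inl]
        split_ifs <;> simp
      have h4 : ∀ e, μ (.inr (.inr (.inr e))) * a (.inr (.inr (.inr e))) x = - (p e * x e) := by
        intro e
        simp only [ha, hp, Sum.elim_inr]
        split_ifs <;> simp
      simp only [Fintype.sum_sum_type, h3, h4] at h1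
      simp only [ha, Sum.elim_inl, Sum.elim_inr, LinearMap.neg_apply, LinearMap.sum_apply,
        LinearMap.smul_apply, LinearMap.proj_apply, smul_eq_mul] at h1
      rw [h1]
      simp only [add_mul, sub_mul, Finset.sum_add_distrib, Finset.sum_sub_distrib, hd,
        Finset.sum_neg_distrib, mul_neg] at h2 ⊢
      linarith
    intro e
    simpa [Pi.single_apply] using hx (Pi.single e 1)
  have hr0 : ∀ e, 0 ≤ r e := fun e => by
    simp only [hr]; split_ifs
    exacts [hμ _, le_rfl]
  refine ⟨fun v => d v - d I.t, p, sub_self _, fun e => ?_, fun e => ?_, fun e he => ?_,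
    fun e he => ?_⟩
  · simp only [hp]; split_ifs
    exacts [hμ _, le_rfl]
  · have := key e
    have := hr0 e
    linarith
  · have := key e
    have hre : r e = 0 := if_neg he.ne'
    linarith
  · by_contra hne
    have : p e = 0 := if_neg hne
    linarith

/-- Restricting an optimal flow to the part that leads to the sink lowers it edgewise, and the
modified costs are nonnegative, so it stays optimal. -/
theorem exists_isComplementary (I : TolledInstance V E) {ybar : E → ℝ} {lam : V → ℝ}
    (h : I.IsSourceThinFlow ybar lam) : ∃ y d p, I.IsComplementary lam y d p := by
  have hc : ∀ e, 0 ≤ I.modCost lam e := fun e =>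
    add_nonneg (mul_nonneg (div_nonneg (h.lam_nonneg _) (h.lam_nonneg _)) (I.transit_nonneg e))
      (I.toll_nonneg e)
  obtain ⟨y₀, hy₀, hmin₀⟩ := I.exists_capFeasible_min (I.modCost lam) ⟨ybar, h.capFeasible⟩
  obtain ⟨y, hy, hle, hreach⟩ := hy₀.1.exists_restriction
  have hyf : I.CapFeasible lam y := ⟨hy, fun e => (hle e).trans (hy₀.2 e)⟩
  have hmin : ∀ y', I.CapFeasible lam y' →
      ∑ e, I.modCost lam e * y e ≤ ∑ e, I.modCost lam e * y' e := fun y' hy' =>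
    (Finset.sum_le_sum fun e _ => mul_le_mul_of_nonneg_left (hle e) (hc e)).trans (hmin₀ y' hy')
  obtain ⟨d, p, hd, hp, h1, h2, h3⟩ := I.exists_potential_of_isMin hyf hmin
  exact ⟨y, d, p, hyf, hd, hp, h1, h2, h3, hreach⟩

end TolledInstance

/-! ### Queues and potentials of the steady flow -/

namespace TolledInstance

variable {V E : Type*}

/-- Constant edge inflow rates `y_e / λ_v`. -/
noncomputable def steadyInflow (I : TolledInstance V E) (lam : V → ℝ) (y : E → ℝ) (e : E)
    (_θ : ℝ) : ℝ :=
  y e / lam (I.src e)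

/-- Edge outflow rates that are `y_e / λ_w` from time `τ_e` on. -/
noncomputable def steadyOutflow (I : TolledInstance V E) (lam : V → ℝ) (y : E → ℝ) (e : E)
    (θ : ℝ) : ℝ :=
  if θ < I.transit e then 0 else y e / lam (I.tgt e)

/-- Initial queueing times `(λ_w / λ_t) p_e`. -/
noncomputable def initialQueue (I : TolledInstance V E) (lam : V → ℝ) (p : E → ℝ) (e : E) : ℝ :=
  lam (I.tgt e) / lam I.t * p e

theorem steadyOutflow_add (I : TolledInstance V E) (lam : V → ℝ) (y : E → ℝ) (e : E) {θ : ℝ}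
    (hθ : 0 ≤ θ) : I.steadyOutflow lam y e (θ + I.transit e) = y e / lam (I.tgt e) :=
  if_neg (by linarith)

theorem steadyOutflow_eq_indicator (I : TolledInstance V E) (lam : V → ℝ) (y : E → ℝ) (e : E) :
    I.steadyOutflow lam y e = (Ici (I.transit e)).indicator fun _ => y e / lam (I.tgt e) := by
  ext θ
  rw [steadyOutflow, indicator_apply]
  by_cases h : θ < I.transit e
  · rw [if_pos h, if_neg (by simpa using h)]
  · rw [if_neg h, if_pos (by simpa using h)]

theorem intervalIntegrable_steadyOutflow (I : TolledInstance V E) (lam : V → ℝ) (y : E → ℝ)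
    (e : E) (a b : ℝ) : IntervalIntegrable (I.steadyOutflow lam y e) volume a b := by
  rw [steadyOutflow_eq_indicator, intervalIntegrable_iff]
  exact (integrableOn_const (by simp)).indicator measurableSet_Ici

theorem integral_steadyOutflow (I : TolledInstance V E) (lam : V → ℝ) (y : E → ℝ) (e : E) {θ : ℝ}
    (hθ : 0 ≤ θ) : ∫ ξ in (0 : ℝ)..(θ + I.transit e), I.steadyOutflow lam y e ξ
      = θ * (y e / lam (I.tgt e)) := by
  have hτ := I.transit_nonneg e
  rw [← intervalIntegral.integral_add_adjacent_intervals
    (I.intervalIntegrable_steadyOutflow lam y e 0 (I.transit e))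
    (I.intervalIntegrable_steadyOutflow lam y e _ _)]
  have h1 : ∫ ξ in (0 : ℝ)..(I.transit e), I.steadyOutflow lam y e ξ = 0 := by
    rw [intervalIntegral.integral_of_le hτ, integral_Ioc_eq_integral_Ioo]
    exact setIntegral_eq_zero_of_forall_eq_zero fun x hx => if_pos hx.2
  have h2 : ∫ ξ in (I.transit e)..(θ + I.transit e), I.steadyOutflow lam y e ξ
      = ∫ ξ in (I.transit e)..(θ + I.transit e), y e / lam (I.tgt e) := by
    refine intervalIntegral.integral_congr fun x hx => ?_
    rw [uIcc_of_le (by linarith)] at hx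
    exact if_neg (not_lt.2 hx.1)
  rw [h1, h2, intervalIntegral.integral_const, smul_eq_mul]
  ring

theorem queueMass_steady (I : TolledInstance V E) (lam : V → ℝ) (y : E → ℝ) (q : E → ℝ) (e : E)
    {θ : ℝ} (hθ : 0 ≤ θ) :
    I.queueMass q (I.steadyInflow lam y) (I.steadyOutflow lam y) e θ
      = θ * (y e / lam (I.src e) - y e / lam (I.tgt e)) + I.cap e * q e := by
  rw [queueMass, I.integral_steadyOutflow lam y e hθ]
  simp only [steadyInflow, intervalIntegral.integral_const, smul_eq_mul]
  ring

theorem isSteadyFrom_steady (I : TolledInstance V E) (lam : V → ℝ) (y : E → ℝ) (q : E → ℝ) :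
    I.IsSteadyFrom q (I.steadyInflow lam y) (I.steadyOutflow lam y) 0 := by
  intro e
  refine ⟨(y e / lam (I.src e) - y e / lam (I.tgt e)) / I.cap e, fun θ hθ => ?_⟩
  have h1 : HasDerivAt (fun θ : ℝ => (θ * (y e / lam (I.src e) - y e / lam (I.tgt e))
      + I.cap e * q e) / I.cap e) ((y e / lam (I.src e) - y e / lam (I.tgt e)) / I.cap e) θ := by
    simpa using (((hasDerivAt_id θ).mul_const
      (y e / lam (I.src e) - y e / lam (I.tgt e))).add_const (I.cap e * q e)).div_const (I.cap e)
  refine h1.hasDerivWithinAt.congr (fun x hx => ?_) ?_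
  · rw [queueTime, I.queueMass_steady lam y q e hx]
  · rw [queueTime, I.queueMass_steady lam y q e hθ]

variable [DecidableEq V] [Fintype E]

section

variable {I : TolledInstance V E} {ybar y : E → ℝ} {lam : V → ℝ} {d : V → ℝ} {p : E → ℝ}

theorem IsSourceThinFlow.lam_pos (h : I.IsSourceThinFlow ybar lam)
    (hlam : ∀ v, lam I.s ≤ lam v) (v : V) : 0 < lam v :=
  zero_lt_one.trans_le (h.lam_source ▸ hlam v)

theorem IsSourceThinFlow.transit_cost_le (hthin : I.IsSourceThinFlow ybar lam) (e : E) :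
    lam I.t / lam (I.tgt e) * I.transit e ≤ I.modCost lam e ∧
      0 ≤ lam I.t / lam (I.tgt e) * I.transit e :=
  ⟨le_add_of_nonneg_right (I.toll_nonneg e),
    mul_nonneg (div_nonneg (hthin.lam_nonneg _) (hthin.lam_nonneg _)) (I.transit_nonneg e)⟩

theorem IsComplementary.potential_le (h : I.IsComplementary lam y d p)
    (hthin : I.IsSourceThinFlow ybar lam) (e : E) (he : 0 < y e) :
    d (I.tgt e) ≤ d (I.src e) := by
  have h1 := h.eq_cost e he
  have h2 := hthin.transit_cost_le e
  have h3 := h.p_nonneg e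
  linarith

/-- On a flow-carrying edge the potential drops by the modified cost plus the price, hence at least
by a positive multiple of the transit time. -/
theorem IsComplementary.transit_eq_zero (h : I.IsComplementary lam y d p)
    (hthin : I.IsSourceThinFlow ybar lam) (hlam : ∀ v, lam I.s ≤ lam v)
    (e : E) (he : 0 < y e) (hd : d (I.src e) ≤ d (I.tgt e)) :
    I.transit e = 0 := by
  have h1 := h.eq_cost e he
  have h2 := hthin.transit_cost_le e
  have h3 := h.p_nonneg e
  have h4 : lam I.t / lam (I.tgt e) * I.transit e = 0 := by linarith
  have h5 := div_pos (hthin.lam_pos hlam I.t) (hthin.lam_pos hlam (I.tgt e))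
  exact (mul_eq_zero.1 h4).resolve_left h5.ne'

variable [Fintype V]

/-- Flow-carrying edges stay within the level sets of a monotone function of the potential that
does not decrease from source to sink. -/
theorem IsComplementary.monotone_eq (h : I.IsComplementary lam y d p)
    (hthin : I.IsSourceThinFlow ybar lam) {φ : ℝ → ℝ} (hφ : Monotone φ)
    (hst : φ (d I.s) ≤ φ (d I.t))
    (e : E) (he : 0 < y e) : φ (d (I.src e)) = φ (d (I.tgt e)) := by
  have hnn : ∀ e, 0 ≤ (φ (d (I.src e)) - φ (d (I.tgt e))) * y e := by
    intro e
    rcases (h.feasible.1.1 e).eq_or_lt with h0 | hpos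
    · rw [← h0, mul_zero]
    · exact mul_nonneg (sub_nonneg.2 (hφ (h.potential_le hthin e hpos))) hpos.le
  have hid := h.feasible.1.sum_potential fun v => φ (d v)
  have hz := (Finset.sum_eq_zero_iff_of_nonneg fun e _ => hnn e).1 (le_antisymm
    (hid.trans_le (mul_nonpos_of_nonneg_of_nonpos I.u_pos.le (sub_nonpos.2 hst)))
    (Finset.sum_nonneg fun e _ => hnn e)) e (Finset.mem_univ e)
  exact sub_eq_zero.1 ((mul_eq_zero.1 hz).resolve_right he.ne')

/-- Truncating the potential at the sink's level gives a function that cannot be lower at the sink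
than at the source, so the flow never goes below level zero once it is there. -/
theorem IsComplementary.potential_eq_zero (h : I.IsComplementary lam y d p)
    (hthin : I.IsSourceThinFlow ybar lam) (e : E) (he : 0 < y e)
    (hd : d (I.src e) = 0) : d (I.tgt e) = 0 := by
  have h1 := h.monotone_eq hthin (φ := fun x => min x 0)
    (fun a b hab => min_le_min_right _ hab) (by simp [h.d_sink]) e he
  have h2 := h.potential_le hthin e he
  simp only [hd, min_self] at h1
  refine le_antisymm (hd ▸ h2) ?_
  rw [h1]
  exact min_le_left _ _

variable (h : I.IsComplementary lam y d p) (hthin : I.IsSourceThinFlow ybar lam)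
  (hlam : ∀ v, lam I.s ≤ lam v)

include h hthin hlam

/-- Either the labels increase along the edge and it is saturated, or they agree, or they
decrease and the edge carries no flow and has price zero. -/
theorem IsComplementary.edge_cases (e : E) :
    (lam (I.src e) < lam (I.tgt e) ∧ y e = lam (I.tgt e) * I.cap e) ∨
      lam (I.src e) = lam (I.tgt e) ∨
      (lam (I.tgt e) < lam (I.src e) ∧ y e = 0 ∧ p e = 0) := by
  rcases lt_trichotomy (lam (I.src e)) (lam (I.tgt e)) with hlt | heq | hgt
  · exact .inl ⟨hlt, (h.feasible.primalFeasible hthin hlam).eq_cap e hlt⟩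
  · exact .inr (.inl heq)
  · have hy := h.feasible.eq_zero hthin hlam e hgt
    refine .inr (.inr ⟨hgt, hy, ((h.p_nonneg e).eq_of_not_lt fun hp => ?_).symm⟩)
    have := h.eq_cap e hp
    have := mul_pos (hthin.lam_pos hlam (I.tgt e)) (I.cap_pos e)
    linarith

/-- If labels increase, the edge is saturated and receives `λ_w / λ_v` times its capacity. Otherwise
inflow and outflow rates agree and the queue is constant. -/
theorem IsComplementary.queueTime_eq (e : E) {θ : ℝ} (hθ : 0 ≤ θ) :
    I.queueTime (I.initialQueue lam p) (I.steadyInflow lam y) (I.steadyOutflow lam y) e θ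
      = θ * (max (lam (I.tgt e) / lam (I.src e)) 1 - 1) + lam (I.tgt e) / lam I.t * p e := by
  have hc := I.cap_pos e
  have hv := hthin.lam_pos hlam (I.src e)
  have hw := hthin.lam_pos hlam (I.tgt e)
  have ht := hthin.lam_pos hlam I.t
  rw [queueTime, I.queueMass_steady lam y _ e hθ, initialQueue]
  rcases h.edge_cases hthin hlam e with ⟨hlt, hy⟩ | heq | ⟨hgt, hy, hp⟩
  · rw [max_eq_left ((one_le_div hv).2 hlt.le), hy]
    field_simp
  · rw [heq, div_self hw.ne', max_self]
    field_simp
    ring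
  · rw [max_eq_right ((div_le_one hv).2 hgt.le), hy, hp]
    simp

/-- Flow returning to the source comes from potential at most `d_s`, by truncation at that level, so
it loses no potential. It thus arrives without delay, and the net outflow at the source is right
from time zero. -/
theorem IsComplementary.transit_eq_zero_of_tgt_source (e : E) (he : 0 < y e)
    (hs : I.tgt e = I.s) : I.transit e = 0 := by
  refine h.transit_eq_zero hthin hlam e he ?_
  have := h.monotone_eq hthin (φ := fun x => max x (d I.s))
    (fun a b hab => max_le_max_right _ hab) (by simp) e he
  simp only [hs, max_self] at this
  rw [hs]
  exact (le_max_left _ _).trans_eq this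

end

end TolledInstance

/-! ### Deficit flow and dynamic equilibrium -/

namespace TolledInstance

variable {V E : Type*} [DecidableEq V] [Fintype E]

theorem net_div (I : TolledInstance V E) (lam : V → ℝ) (y z : E → ℝ) (v : V) :
    I.net (fun e => y e / lam (I.src e)) (fun e => z e / lam (I.tgt e)) v
      = I.net y z v / lam v := by
  have hout : ∑ e with I.src e = v, y e / lam (I.src e) = (∑ e with I.src e = v, y e) / lam v := by
    rw [Finset.sum_div]
    exact Finset.sum_congr rfl fun e he => by rw [(Finset.mem_filter.1 he).2]
  have hin : ∑ e with I.tgt e = v, z e / lam (I.tgt e) = (∑ e with I.tgt e = v, z e) / lam v := by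
    rw [Finset.sum_div]
    exact Finset.sum_congr rfl fun e he => by rw [(Finset.mem_filter.1 he).2]
  rw [net, net, hout, hin, sub_div]

theorem net_steady (I : TolledInstance V E) (lam : V → ℝ) (y : E → ℝ) (v : V) (θ : ℝ) :
    I.net (fun e => I.steadyInflow lam y e θ) (fun e => I.steadyOutflow lam y e θ) v
      = I.net y (fun e => if θ < I.transit e then 0 else y e) v / lam v := by
  rw [← net_div]
  simp only [steadyInflow, steadyOutflow, ite_div, zero_div]

theorem net_congr_right (I : TolledInstance V E) {y z z' : E → ℝ} {v : V}
    (h : ∀ e, I.tgt e = v → z e = z' e) : I.net y z v = I.net y z' v := by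
  rw [net, net, Finset.sum_congr rfl fun e he => h e (Finset.mem_filter.1 he).2]

theorem net_anti_right (I : TolledInstance V E) {y z z' : E → ℝ} (v : V)
    (h : ∀ e, z e ≤ z' e) : I.net y z' v ≤ I.net y z v :=
  sub_le_sub_left (Finset.sum_le_sum fun e _ => h e) _

section

variable {I : TolledInstance V E} {ybar y : E → ℝ} {lam : V → ℝ} {d : V → ℝ} {p : E → ℝ}
  [Fintype V]
variable (h : I.IsComplementary lam y d p) (hthin : I.IsSourceThinFlow ybar lam)
  (hlam : ∀ v, lam I.s ≤ lam v)

include h hthin hlam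

/-- The sink never sends out more flow than it receives. -/
theorem IsComplementary.net_sink_nonpos {θ : ℝ} (hθ : 0 ≤ θ) :
    I.net y (fun e => if θ < I.transit e then 0 else y e) I.t ≤ 0 := by
  classical
  -- Flow leaving the sink stays on the zero level of `d` and travels there with transit time zero.
  -- Testing with the rest of this level shows that what leaves the sink is matched by flow already
  -- returning to it.
  set g : V → ℝ := fun v => if d v = 0 ∧ v ≠ I.t then 1 else 0 with hg
  have hgt : g I.t = 0 := by simp [hg]
  have hgs : 0 ≤ g I.s := by
    simp only [hg]
    split_ifs <;> norm_num
  have hid := h.feasible.1.sum_potential g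
  have hnet : I.net y (fun e => if θ < I.transit e then 0 else y e) I.t
      = ∑ e, ((if I.src e = I.t then y e else 0)
        - if I.tgt e = I.t then (if θ < I.transit e then 0 else y e) else 0) := by
    rw [net, Finset.sum_sub_distrib, Finset.sum_filter, Finset.sum_filter]
  have hle : ∀ e, ((if I.src e = I.t then y e else 0)
        - if I.tgt e = I.t then (if θ < I.transit e then 0 else y e) else 0)
      ≤ - ((g (I.src e) - g (I.tgt e)) * y e) := by
    intro e
    rcases (h.feasible.1.1 e).eq_or_lt with h0 | hpos
    · simp [← h0]
    · have hstep : d (I.src e) = 0 → d (I.tgt e) = 0 ∧ ¬ θ < I.transit e := by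
        intro h1
        have h2 := h.potential_eq_zero hthin e hpos h1
        refine ⟨h2, ?_⟩
        rw [h.transit_eq_zero hthin hlam e hpos (by rw [h1, h2])]
        exact not_lt.2 hθ
      have hy := hpos.le
      by_cases h1 : I.src e = I.t
      · have h2 := hstep (by rw [h1, h.d_sink])
        by_cases h3 : I.tgt e = I.t
        · simp [h1, h3, h2.2]
        · simp [hg, h1, h3, h2.1]
      · by_cases h3 : I.tgt e = I.t
        · by_cases h4 : d (I.src e) = 0
          · simp [hg, h1, h3, h4, (hstep h4).2]
          · have : 0 ≤ if θ < I.transit e then 0 else y e := by split_ifs <;> linarith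
            simpa [hg, h1, h3, h4] using this
        · by_cases h4 : d (I.src e) = 0
          · simp [hg, h1, h3, h4, (hstep h4).1]
          · by_cases h5 : d (I.tgt e) = 0
            · simpa [hg, h1, h3, h4, h5] using hy
            · simp [hg, h1, h3, h4, h5]
  rw [hnet]
  refine (Finset.sum_le_sum fun e _ => hle e).trans ?_
  rw [Finset.sum_neg_distrib, hid, hgt, sub_zero]
  have := mul_nonneg I.u_pos.le hgs
  linarith

theorem IsComplementary.isDeficitFlow :
    I.IsDeficitFlow I.tauMax (I.initialQueue lam p) (I.steadyInflow lam y)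
      (I.steadyOutflow lam y) := by
  have hy := h.feasible.1.1
  have lp := hthin.lam_pos hlam
  have hq : ∀ e, 0 ≤ I.initialQueue lam p e := fun e =>
    mul_nonneg (div_nonneg (lp _).le (lp _).le) (h.p_nonneg e)
  have hout : ∀ θ e, (if θ < I.transit e then 0 else y e) ≤ y e := by
    intro θ e
    have := hy e
    split_ifs <;> linarith
  have hcap : ∀ e, y e / lam (I.tgt e) ≤ I.cap e := fun e => by
    rw [div_le_iff₀ (lp _), mul_comm]
    exact h.feasible.2 e
  have hrate : ∀ e, y e / lam (I.tgt e) ≤ y e / lam (I.src e) := by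
    intro e
    rcases h.edge_cases hthin hlam e with ⟨hlt, -⟩ | heq | ⟨-, h0, -⟩
    · exact div_le_div_of_nonneg_left (hy e) (lp _) hlt.le
    · rw [heq]
    · simp [h0]
  refine ⟨hq, fun e θ _ => div_nonneg (hy e) (lp _).le, fun e θ _ => ?_,
    fun e θ _ => intervalIntegrable_const,
    fun e θ _ => I.intervalIntegrable_steadyOutflow lam y e 0 θ, fun e θ _ hθ => if_pos hθ,
    fun e θ hθ => ?_, fun e θ hθ hpos => ?_, fun e θ hθ hzero => ?_, fun θ hθ => ?_,
    fun θ hθ => ?_, fun v hvs hvt θ hθ => ?_, fun v hvs hvt θ hθ hT => ?_⟩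
  · rw [steadyOutflow]
    split_ifs
    exacts [le_rfl, div_nonneg (hy e) (lp _).le]
  · rw [I.queueMass_steady lam y _ e hθ]
    exact add_nonneg (mul_nonneg hθ (sub_nonneg.2 (hrate e))) (mul_nonneg (I.cap_pos e).le (hq e))
  · rw [I.queueMass_steady lam y _ e hθ] at hpos
    rw [I.steadyOutflow_add lam y e hθ]
    -- A queue is positive only if labels increase or the price is positive; either way the edge is
    -- saturated.
    have hsat : y e = lam (I.tgt e) * I.cap e := by
      rcases h.edge_cases hthin hlam e with ⟨-, hsat⟩ | heq | ⟨-, h0, hp⟩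
      · exact hsat
      · refine h.eq_cap e ((h.p_nonneg e).lt_of_ne fun hp => ?_)
        simp [heq, initialQueue, ← hp] at hpos
      · simp [h0, initialQueue, hp] at hpos
    rw [hsat, mul_div_cancel_left₀ _ (lp _).ne']
  · rw [I.steadyOutflow_add lam y e hθ, steadyInflow]
    refine le_antisymm (le_min (hrate e) (hcap e)) ?_
    rcases h.edge_cases hthin hlam e with ⟨-, hsat⟩ | heq | ⟨-, h0, -⟩
    · refine (min_le_right _ _).trans_eq ?_
      rw [hsat, mul_div_cancel_left₀ _ (lp _).ne']
    · rw [heq]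
      exact min_le_left _ _
    · rw [h0, zero_div, zero_div]
      exact min_le_left _ _
  · rw [net_steady, hthin.lam_source, div_one, ← h.feasible.1.2.1]
    refine I.net_congr_right fun e he => ?_
    split_ifs with hlt
    · refine (hy e).eq_of_not_lt fun hpos => ?_
      rw [h.transit_eq_zero_of_tgt_source hthin hlam e hpos he] at hlt
      linarith
    · rfl
  · rw [net_steady]
    exact div_nonpos_of_nonpos_of_nonneg (h.net_sink_nonpos hthin hlam hθ) (lp _).le
  · rw [net_steady]
    refine div_nonneg ?_ (lp _).le
    exact (h.feasible.1.2.2 v hvs hvt).symm.trans_le (I.net_anti_right v (hout θ))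
  · rw [net_steady, I.net_congr_right (z' := y), h.feasible.1.2.2 v hvs hvt, zero_div]
    intro e _
    exact if_neg (not_lt.2 ((le_ciSup (Set.finite_range I.transit).bddAbove e).trans hT))

/-- The affine functions `(λ_t / λ_v - 1) θ + d_v` satisfy the inequalities of the shortest path
recursion, with equality along flow-carrying edges. -/
theorem IsComplementary.potential_recursion (e : E) {θ : ℝ} (hθ : 0 ≤ θ) :
    let Q := I.queueTime (I.initialQueue lam p) (I.steadyInflow lam y) (I.steadyOutflow lam y)
    (lam I.t / lam (I.src e) - 1) * θ + d (I.src e) ≤ I.transit e + Q e θ + I.toll e +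
        ((lam I.t / lam (I.tgt e) - 1) * (θ + I.transit e + Q e θ) + d (I.tgt e)) ∧
      (0 < y e → (lam I.t / lam (I.src e) - 1) * θ + d (I.src e)
        = I.transit e + Q e θ + I.toll e +
          ((lam I.t / lam (I.tgt e) - 1) * (θ + I.transit e + Q e θ) + d (I.tgt e))) := by
  intro Q
  have hv := hthin.lam_pos hlam (I.src e)
  have hw := hthin.lam_pos hlam (I.tgt e)
  have ht := hthin.lam_pos hlam I.t
  have hQ : Q e θ = _ := h.queueTime_eq hthin hlam e hθ
  have hcost := h.le_cost e
  rw [modCost] at hcost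
  have key : lam I.t / lam (I.src e) ≤
      lam I.t / lam (I.tgt e) * max (lam (I.tgt e) / lam (I.src e)) 1 ∧ (0 < y e →
      lam I.t / lam (I.src e) =
        lam I.t / lam (I.tgt e) * max (lam (I.tgt e) / lam (I.src e)) 1) := by
    have heq : lam I.t / lam (I.src e) = lam I.t / lam (I.tgt e) *
        (lam (I.tgt e) / lam (I.src e)) := by field_simp
    refine ⟨?_, fun hy => ?_⟩
    · rw [heq]
      exact mul_le_mul_of_nonneg_left (le_max_left _ _) (div_pos ht hw).le
    · rw [max_eq_left, heq]
      rw [one_le_div hv]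
      rcases h.edge_cases hthin hlam e with ⟨hlt, -⟩ | heq | ⟨-, h0, -⟩
      exacts [hlt.le, heq.le, absurd h0 hy.ne']
  -- A delay on `e` is weighted by `λ_t / λ_w` at its head, so the initial queue contributes exactly
  -- `p e`; this dictates its scaling.
  have expand : I.transit e + Q e θ + I.toll e +
        ((lam I.t / lam (I.tgt e) - 1) * (θ + I.transit e + Q e θ) + d (I.tgt e))
      = (lam I.t / lam (I.tgt e) * max (lam (I.tgt e) / lam (I.src e)) 1 - 1) * θ
        + (lam I.t / lam (I.tgt e) * I.transit e + I.toll e + p e + d (I.tgt e)) := by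
    rw [hQ]
    field_simp
    ring
  rw [expand]
  refine ⟨?_, fun hy => ?_⟩
  · have := mul_le_mul_of_nonneg_right key.1 hθ
    linarith
  · have hc := h.eq_cost e hy
    rw [modCost] at hc
    rw [← key.2 hy]
    linarith

theorem IsComplementary.queueTime_nonneg (e : E) {θ : ℝ} (hθ : 0 ≤ θ) :
    0 ≤ I.queueTime (I.initialQueue lam p) (I.steadyInflow lam y) (I.steadyOutflow lam y) e θ :=
  div_nonneg ((h.isDeficitFlow hthin hlam).queue_nonneg e θ hθ) (I.cap_pos e).le

theorem IsComplementary.le_walkCost (l : List E) :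
    ∀ (v : V) (θ : ℝ), 0 ≤ θ → I.IsWalkToSink v l → (lam I.t / lam v - 1) * θ + d v ≤
      I.walkCost (I.queueTime (I.initialQueue lam p) (I.steadyInflow lam y)
        (I.steadyOutflow lam y)) l θ := by
  induction l with
  | nil =>
    rintro v θ - rfl
    simp [walkCost, h.d_sink, div_self (hthin.lam_pos hlam I.t).ne']
  | cons e l ih =>
    rintro v θ hθ ⟨rfl, hl⟩
    have h1 := h.queueTime_nonneg hthin hlam e hθ
    have h2 := I.transit_nonneg e
    refine (h.potential_recursion hthin hlam e hθ).1.trans ?_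
    rw [walkCost]
    gcongr
    exact ih _ _ (by positivity) hl

/-- The affine function bounds the cost of every walk from below by `le_walkCost`, and a walk of
flow-carrying edges attains it because the recursion is an equality there. -/
theorem IsComplementary.minCost_eq {v : V} (hv : Relation.ReflTransGen
      (fun a b => ∃ e, 0 < y e ∧ I.src e = a ∧ I.tgt e = b) v I.t) {θ : ℝ} (hθ : 0 ≤ θ) :
    I.minCost (I.queueTime (I.initialQueue lam p) (I.steadyInflow lam y)
      (I.steadyOutflow lam y)) v θ = (lam I.t / lam v - 1) * θ + d v := by
  refine IsLeast.csInf_eq ⟨?_, ?_⟩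
  · induction hv using Relation.ReflTransGen.head_induction_on generalizing θ with
    | refl =>
      exact ⟨[], rfl, by simp [walkCost, h.d_sink, div_self (hthin.lam_pos hlam I.t).ne']⟩
    | head hab _ ih =>
      obtain ⟨e, he, rfl, rfl⟩ := hab
      have h1 := h.queueTime_nonneg hthin hlam e hθ
      have h2 := I.transit_nonneg e
      obtain ⟨l, hl, hcost⟩ := ih (θ := θ + I.transit e + I.queueTime (I.initialQueue lam p)
        (I.steadyInflow lam y) (I.steadyOutflow lam y) e θ) (by positivity)
      refine ⟨e :: l, ⟨rfl, hl⟩, ?_⟩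
      rw [walkCost, ← hcost]
      exact (h.potential_recursion hthin hlam e hθ).2 he
  · rintro x ⟨l, hl, rfl⟩
    exact h.le_walkCost hthin hlam l v θ hθ hl

theorem IsComplementary.isDynamicEquilibrium :
    I.IsDynamicEquilibrium (I.initialQueue lam p) (I.steadyInflow lam y)
      (I.steadyOutflow lam y) := by
  intro e
  refine ae_restrict_of_forall_mem measurableSet_Ici fun θ hθ hpos => ?_
  have hθ : 0 ≤ θ := hθ
  have he : 0 < y e := (div_pos_iff_of_pos_right (hthin.lam_pos hlam _)).1 hpos
  have hreach := h.reach e he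
  have h1 := h.queueTime_nonneg hthin hlam e hθ
  have h2 := I.transit_nonneg e
  rw [IsActive, h.minCost_eq hthin hlam (.head ⟨e, he, rfl, rfl⟩ hreach) hθ,
    h.minCost_eq hthin hlam hreach (by positivity)]
  exact (h.potential_recursion hthin hlam e hθ).2 he

end

end TolledInstance

theorem mainTheorem1 {V E : Type*} [Fintype V] [DecidableEq V] [Fintype E]
    (I : TolledInstance V E) :
    ∃ (fin fout : E → ℝ → ℝ) (q : E → ℝ),
      I.IsDeficitFlow I.tauMax q fin fout ∧
      (∀ e, ∃ a : ℝ, ∀ θ, 0 ≤ θ → fin e θ = a) ∧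
      I.IsSteadyFrom q fin fout 0 ∧
      I.IsDynamicEquilibrium q fin fout ∧
      ∃ (ybar : E → ℝ) (lam : V → ℝ) (y : E → ℝ) (d : V → ℝ) (p : E → ℝ),
        I.IsSourceThinFlow ybar lam ∧
        (∀ v, lam I.s ≤ lam v ∧ lam v ≤ lam I.t) ∧
        I.PrimalOptimal lam y ∧
        I.DualOptimal lam d p ∧
        d I.t = 0 ∧
        (∀ e, 0 ≤ p e) ∧
        (∀ e θ, 0 ≤ θ → fin e θ = y e / lam (I.src e)) ∧
        (∀ e, q e = lam (I.tgt e) / lam I.t * p e) := by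
  obtain ⟨ybar, lam, hthin, hlam⟩ := I.exists_isSourceThinFlow
  obtain ⟨y, d, p, h⟩ := I.exists_isComplementary hthin
  have hlam' : ∀ v, lam I.s ≤ lam v := fun v => (hlam v).1
  exact ⟨I.steadyInflow lam y, I.steadyOutflow lam y, I.initialQueue lam p,
    h.isDeficitFlow hthin hlam', fun e => ⟨y e / lam (I.src e), fun _ _ => rfl⟩,
    I.isSteadyFrom_steady lam y _, h.isDynamicEquilibrium hthin hlam',
    ybar, lam, y, d, p, hthin, hlam, h.primalOptimal hthin hlam', h.dualOptimal hthin hlam',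
    h.d_sink, h.p_nonneg, fun _ _ _ => rfl, fun _ => rfl⟩
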